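/- **Setting.** Let $\Omega=[-1,1]^2$ and let $\mathbb P^k$ be the space of real polynomials in $x,y$ of total degree at most $k$. Write $\langle p\rangle_\Omega$ for the average of $p$ over $\Omega$, $\langle p\rangle^x_\Omega$ for the average of $p$ over the two edges $x=\pm1$, $\langle p\rangle^y_\Omega$ for the average of $p$ over the two edges $y=\pm1$, and $\overline{p(a,b)}=\frac14[p(a,b)+p(-a,b)+p(a,-b)+p(-a,-b)]$. For $\theta\in[-1,1]$, a *symmetric cell average decomposition* (CAD) for $\mathbb P^k$ with boundary weight $\overline\omega>0$ is an identity $$\langle p\rangle_\Omega=\overline\omega\,\big[(1+\theta)\langle p\rangle^x_\Omega+(1-\theta)\langle p\rangle^y_\Omega\big]+\sum_{s=1}^S\omega_s\,\overline{p(x^{(s)},y^{(s)})}\qquad\forall p\in\mathbb P^k$$ with $\omega_s>0$ and $(x^{(s)},y^{(s)})\in[0,1]^2$ for all $s$. It is *optimal* (an OCAD) if no symmetric CAD for the same $\theta$ and $\mathbb P^k$ (with any number $S$ of node orbits) has a larger boundary weight; the supremum of the boundary weights is denoted $\overline\omega_\star(\theta,\mathbb P^k)$. Let $\mathbb P^k_+$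 be the set of $p\in\mathbb P^k$ that are nonnegative on $\Omega$ and $(\mathbb P^k)^2=\{q^2:q\in\mathbb P^k\}$. Put $$\phi(p;\theta)=\frac{\langle p\rangle_\Omega}{(1+\theta)\langle p\rangle^x_\Omega+(1-\theta)\langle p\rangle^y_\Omega}$$ ($+\infty$ if the denominator is $0$) and $\phi^\star(\theta,A)=\inf_{p\in A}\phi(p;\theta)$. A *critical positive polynomial* is a nonzero $p\in\mathbb P^k_+$ with $\phi(p;\theta)=\phi^\star(\theta,\mathbb P^k_+)$. **Theorem.** Let $\theta\in[-1,1]$ and $k\in\{6,7\}$, and set $$\overline\omega_\star=\left[2|\theta|+\frac{20}3+\frac23\sqrt{126\theta^2+96|\theta|+94}\,\cos\!\left(\frac13\arccos\frac{864|\theta|^3+2916\theta^2+288|\theta|-532}{(126\theta^2+96|\theta|+94)^{3/2}}\right)\right]^{-1},$$ $$m_{ij}=\frac1{(i+1)(j+1)}-\overline\omega_\star\left[\frac{1+\theta}{1+j}+\frac{1-\theta}{1+i}\right].$$ (a) The following is a symmetric OCAD for $\mathbb P^k$, with four distinct internal node orbits: $$\langle p\rangle_\Omega=\overline\omega_\star\big[(1+\theta)\langle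 p\rangle^x_\Omega+(1-\theta)\langle p\rangle^y_\Omega\big]+\sum_{s=1}^4\omega_s\,\overline{p(x^{(s)},y^{(s)})}.$$ Its nodes and internal weights are given by the formulas below; at $\theta=0$ both sets of formulas are valid. If $\theta\in[-1,0]$: $$\beta_1=1-\frac{m_{22}^2}{m_{42}m_{02}}+\frac{\sqrt{30}+2}{36}\theta^2,\quad \beta_2=m_{42}m_{02}-m_{22}^2,\quad \beta_3=m_{06}m_{02}-m_{04}^2,$$ $$x^{(1)}=\sqrt{\tfrac{1}{m_{02}}\Big(m_{22}-\sqrt{\tfrac{(1-\beta_1)\beta_2}{\beta_1}}\Big)},\quad y^{(1)}=\sqrt{\tfrac{1}{m_{02}}\Big(m_{04}+\sqrt{\tfrac{(1-\beta_1)\beta_3}{\beta_1}}\Big)},\quad \omega_1=\frac{\beta_1m_{02}}{(y^{(1)})^2},$$ $$x^{(2)}=\sqrt{\tfrac{1}{m_{02}}\Big(m_{22}+\sqrt{\tfrac{\beta_1\beta_2}{1-\beta_1}}\Big)},\quad y^{(2)}=\sqrt{\tfrac{1}{m_{02}}\Big(m_{04}-\sqrt{\tfrac{\beta_1\beta_3}{1-\beta_1}}\Big)},\quad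 \omega_2=\frac{(1-\beta_1)m_{02}}{(y^{(2)})^2},$$ $m_n=m_{n0}-\omega_1(x^{(1)})^n-\omega_2(x^{(2)})^n$ for $n=0,2,4,6$, and $(x^{(3)},y^{(3)})=(z_3,0)$, $(x^{(4)},y^{(4)})=(z_4,0)$. If $\theta\in[0,1]$: $$\beta_1=1-\frac{m_{22}^2}{m_{24}m_{20}}+\frac{\sqrt{30}+2}{36}\theta^2,\quad \beta_2=m_{60}m_{20}-m_{40}^2,\quad \beta_3=m_{24}m_{20}-m_{22}^2,$$ $$x^{(1)}=\sqrt{\tfrac{1}{m_{20}}\Big(m_{40}+\sqrt{\tfrac{(1-\beta_1)\beta_2}{\beta_1}}\Big)},\quad y^{(1)}=\sqrt{\tfrac{1}{m_{20}}\Big(m_{22}-\sqrt{\tfrac{(1-\beta_1)\beta_3}{\beta_1}}\Big)},\quad \omega_1=\frac{\beta_1m_{20}}{(x^{(1)})^2},$$ $$x^{(2)}=\sqrt{\tfrac{1}{m_{20}}\Big(m_{40}-\sqrt{\tfrac{\beta_1\beta_2}{1-\beta_1}}\Big)},\quad y^{(2)}=\sqrt{\tfrac{1}{m_{20}}\Big(m_{22}+\sqrt{\tfrac{\beta_1\beta_3}{1-\beta_1}}\Big)},\quad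 \omega_2=\frac{(1-\beta_1)m_{20}}{(x^{(2)})^2},$$ $m_n=m_{0n}-\omega_1(y^{(1)})^n-\omega_2(y^{(2)})^n$ for $n=0,2,4,6$, and $(x^{(3)},y^{(3)})=(0,z_3)$, $(x^{(4)},y^{(4)})=(0,z_4)$. In both cases $$\beta_4=\frac{m_6m_0^2-3m_4m_2m_0+2m_2^3}{(m_4m_0-m_2^2)^{3/2}},\quad \omega_3=\frac{m_0}2\Big(1+\frac{\beta_4}{\sqrt{\beta_4^2+4}}\Big),\quad \omega_4=\frac{m_0}2\Big(1-\frac{\beta_4}{\sqrt{\beta_4^2+4}}\Big),$$ $$z_3=\sqrt{\frac{m_2}{m_0}-\sqrt{\frac{\omega_4}{\omega_3}}\frac{\sqrt{m_4m_0-m_2^2}}{m_0}},\qquad z_4=\sqrt{\frac{m_2}{m_0}+\sqrt{\frac{\omega_3}{\omega_4}}\frac{\sqrt{m_4m_0-m_2^2}}{m_0}}.$$ (b) We have $$\overline\omega_\star(\theta,\mathbb P^k)=\overline\omega_\star=\phi^\star(\theta,\mathbb P^k_+)=\phi^\star\big(\theta,(\mathbb P^3)^2\big),$$ and there is a critical positive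 polynomial for $\phi^\star(\theta,\mathbb P^k_+)$, even one of the form $q^2$ with $0\ne q\in\mathbb P^3$. (c) Let $b_1,\dots,b_{10}$ be the monomials of degree at most $3$, let $\mathbf M_\Omega=(\langle b_ib_j\rangle_\Omega)_{i,j}$ and $\mathbf M_\theta=\big((1+\theta)\langle b_ib_j\rangle^x_\Omega+(1-\theta)\langle b_ib_j\rangle^y_\Omega\big)_{i,j}$. Then $\overline\omega_\star$ is the smallest real root $\phi$ of $\det(\mathbf M_\Omega-\phi\,\mathbf M_\theta)$. -/

import Mathlib

/-! Cell average decompositions (CADs) on the reference cell `Ω = [-1,1]²`. -/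

namespace OCAD

/-- Real polynomials in the two variables `x = X 0` and `y = X 1`. -/
abbrev Poly : Type := MvPolynomial (Fin 2) ℝ

/-- The value `p(x,y)`. -/
noncomputable def val (p : Poly) (x y : ℝ) : ℝ := MvPolynomial.eval ![x, y] p

/-- The space `ℙ^k` of polynomials of total degree at most `k`. -/
noncomputable def polySpace (k : ℕ) : Submodule ℝ Poly :=
  MvPolynomial.restrictTotalDegree (Fin 2) ℝ k

/-- The cell average `⟨p⟩_Ω`. -/
noncomputable def avg (p : Poly) : ℝ :=
  (1 / 4) * ∫ x in (-1 : ℝ)..1, ∫ y in (-1 : ℝ)..1, val p x y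

/-- `⟨p⟩_Ω^x`: the mean of the averages of `p` over the two edges `x = -1` and `x = 1`. -/
noncomputable def avgX (p : Poly) : ℝ :=
  (1 / 2) * ((1 / 2) * (∫ y in (-1 : ℝ)..1, val p (-1) y) +
    (1 / 2) * (∫ y in (-1 : ℝ)..1, val p 1 y))

/-- `⟨p⟩_Ω^y`: the mean of the averages of `p` over the two edges `y = -1` and `y = 1`. -/
noncomputable def avgY (p : Poly) : ℝ :=
  (1 / 2) * ((1 / 2) * (∫ x in (-1 : ℝ)..1, val p x (-1)) +
    (1 / 2) * (∫ x in (-1 : ℝ)..1, val p x 1))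

/-- The boundary functional `(1+θ)⟨p⟩_Ω^x + (1-θ)⟨p⟩_Ω^y`. -/
noncomputable def bdry (θ : ℝ) (p : Poly) : ℝ := (1 + θ) * avgX p + (1 - θ) * avgY p

/-- The mean of `p` over the four points `(±x, ±y)`. -/
noncomputable def symMean (p : Poly) (x y : ℝ) : ℝ :=
  (1 / 4) * (val p x y + val p (-x) y + val p x (-y) + val p (-x) (-y))

/-- `⟨p⟩_Ω = w [(1+θ)⟨p⟩^x + (1-θ)⟨p⟩^y] + ∑ₛ ωₛ mean of p over (±xₛ,±yₛ)` is a feasible symmetric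
CAD for the space `V`. -/
structure IsSymmetricCAD (V : Submodule ℝ Poly) (θ w : ℝ) {S : ℕ} (ω x y : Fin S → ℝ) :
    Prop where
  exact : ∀ p ∈ V, avg p = w * bdry θ p + ∑ s, ω s * symMean p (x s) (y s)
  boundary_pos : 0 < w
  weight_pos : ∀ s, 0 < ω s
  node_x : ∀ s, x s ∈ Set.Icc (0 : ℝ) 1
  node_y : ∀ s, y s ∈ Set.Icc (0 : ℝ) 1

/-- The boundary weights of all symmetric CADs for `V`, with any finite number of node orbits. -/
def feasibleWeights (V : Submodule ℝ Poly) (θ : ℝ) : Set ℝ :=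
  {w | ∃ (S : ℕ) (ω x y : Fin S → ℝ), IsSymmetricCAD V θ w ω x y}

/-- The optimal boundary weight `ω̄⋆(θ,V)`. -/
noncomputable def optimalWeight (V : Submodule ℝ Poly) (θ : ℝ) : ℝ := sSup (feasibleWeights V θ)

/-- A symmetric optimal CAD: a symmetric CAD whose boundary weight is largest. -/
structure IsSymmetricOCAD (V : Submodule ℝ Poly) (θ w : ℝ) {S : ℕ} (ω x y : Fin S → ℝ) :
    Prop where
  isCAD : IsSymmetricCAD V θ w ω x y
  isOptimal : ∀ w' ∈ feasibleWeights V θ, w' ≤ w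

/-! ### The dual quantities -/

/-- `V₊`: the polynomials in `V` that are nonnegative on `Ω`. -/
def nonnegPart (V : Submodule ℝ Poly) : Set Poly :=
  {p | p ∈ V ∧ ∀ x ∈ Set.Icc (-1 : ℝ) 1, ∀ y ∈ Set.Icc (-1 : ℝ) 1, 0 ≤ val p x y}

/-- `V²`: the squares of the polynomials in `V`. -/
def squares (V : Submodule ℝ Poly) : Set Poly := {p | ∃ q ∈ V, p = q ^ 2}

open Classical in
/-- `φ(p;θ) = ⟨p⟩_Ω / ((1+θ)⟨p⟩^x + (1-θ)⟨p⟩^y)`, which is `+∞` if the denominator is zero. -/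
noncomputable def phi (θ : ℝ) (p : Poly) : EReal :=
  if bdry θ p = 0 then ⊤ else ((avg p / bdry θ p : ℝ) : EReal)

/-- `φ⋆(θ,A)`: the infimum of `φ(p;θ)` over `p ∈ A`. -/
noncomputable def phiStar (θ : ℝ) (A : Set Poly) : EReal := ⨅ p ∈ A, phi θ p

/-- `p` is a critical positive polynomial for `φ⋆(θ,V₊)`. -/
def IsCriticalPositive (V : Submodule ℝ Poly) (θ : ℝ) (p : Poly) : Prop :=
  p ∈ nonnegPart V ∧ p ≠ 0 ∧ phi θ p = phiStar θ (nonnegPart V)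

/-- The ten monomials of degree at most three. -/
noncomputable def cubicMonomials : Fin 10 → Poly :=
  let x : Poly := MvPolynomial.X 0
  let y : Poly := MvPolynomial.X 1
  ![1, x, y, x ^ 2, x * y, y ^ 2, x ^ 3, x ^ 2 * y, x * y ^ 2, y ^ 3]

/-- The matrix `M_Ω` of `⟨b_i b_j⟩_Ω` in the monomial basis of `ℙ^3`. -/
noncomputable def massMatrix : Matrix (Fin 10) (Fin 10) ℝ :=
  Matrix.of fun i j => avg (cubicMonomials i * cubicMonomials j)

/-- The matrix `M_θ = (1+θ) M_Ω^x + (1-θ) M_Ω^y` in the monomial basis of `ℙ^3`. -/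
noncomputable def bdryMatrix (θ : ℝ) : Matrix (Fin 10) (Fin 10) ℝ :=
  (1 + θ) • (Matrix.of fun i j => avgX (cubicMonomials i * cubicMonomials j)) +
    (1 - θ) • (Matrix.of fun i j => avgY (cubicMonomials i * cubicMonomials j))

/-! ### The explicit decomposition -/

/-- The boundary weight. -/
noncomputable def wStar (θ : ℝ) : ℝ :=
  (2 * |θ| + 20 / 3 + 2 / 3 * √(126 * θ ^ 2 + 96 * |θ| + 94) *
    Real.cos (1 / 3 * Real.arccos
      ((864 * |θ| ^ 3 + 2916 * θ ^ 2 + 288 * |θ| - 532) /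
        (126 * θ ^ 2 + 96 * |θ| + 94) ^ (3 / 2 : ℝ))))⁻¹

/-- The moments `m_{ij}`. -/
noncomputable def mom (θ : ℝ) (i j : ℕ) : ℝ :=
  1 / (((i : ℝ) + 1) * ((j : ℝ) + 1)) -
    wStar θ * ((1 + θ) / (1 + (j : ℝ)) + (1 - θ) / (1 + (i : ℝ)))

/-! The third and fourth node orbits lie on a coordinate axis. Their weights `ω₃, ω₄` and their
coordinates `z₃, z₄` on that axis depend on the residual moments `m 0, m 2, m 4, m 6`. -/

/-- `β₄`. -/
noncomputable def beta4 (m : ℕ → ℝ) : ℝ :=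
  (m 6 * m 0 ^ 2 - 3 * m 4 * m 2 * m 0 + 2 * m 2 ^ 3) / (m 4 * m 0 - m 2 ^ 2) ^ (3 / 2 : ℝ)

/-- `ω₃`. -/
noncomputable def weight3 (m : ℕ → ℝ) : ℝ := m 0 / 2 * (1 + beta4 m / √(beta4 m ^ 2 + 4))

/-- `ω₄`. -/
noncomputable def weight4 (m : ℕ → ℝ) : ℝ := m 0 / 2 * (1 - beta4 m / √(beta4 m ^ 2 + 4))

/-- `z₃`. -/
noncomputable def coord3 (m : ℕ → ℝ) : ℝ :=
  √(m 2 / m 0 - √(weight4 m / weight3 m) * (√(m 4 * m 0 - m 2 ^ 2) / m 0))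

/-- `z₄`. -/
noncomputable def coord4 (m : ℕ → ℝ) : ℝ :=
  √(m 2 / m 0 + √(weight3 m / weight4 m) * (√(m 4 * m 0 - m 2 ^ 2) / m 0))

/-! #### The formulas for `θ ∈ [-1,0]` -/

namespace Neg

noncomputable def beta1 (θ : ℝ) : ℝ :=
  1 - mom θ 2 2 ^ 2 / (mom θ 4 2 * mom θ 0 2) + (√30 + 2) / 36 * θ ^ 2

noncomputable def beta2 (θ : ℝ) : ℝ := mom θ 4 2 * mom θ 0 2 - mom θ 2 2 ^ 2

noncomputable def beta3 (θ : ℝ) : ℝ := mom θ 0 6 * mom θ 0 2 - mom θ 0 4 ^ 2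

noncomputable def x1 (θ : ℝ) : ℝ :=
  √((mom θ 2 2 - √((1 - beta1 θ) * beta2 θ / beta1 θ)) / mom θ 0 2)

noncomputable def y1 (θ : ℝ) : ℝ :=
  √((mom θ 0 4 + √((1 - beta1 θ) * beta3 θ / beta1 θ)) / mom θ 0 2)

noncomputable def weight1 (θ : ℝ) : ℝ := beta1 θ * mom θ 0 2 / y1 θ ^ 2

noncomputable def x2 (θ : ℝ) : ℝ :=
  √((mom θ 2 2 + √(beta1 θ * beta2 θ / (1 - beta1 θ))) / mom θ 0 2)

noncomputable def y2 (θ : ℝ) : ℝ :=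
  √((mom θ 0 4 - √(beta1 θ * beta3 θ / (1 - beta1 θ))) / mom θ 0 2)

noncomputable def weight2 (θ : ℝ) : ℝ := (1 - beta1 θ) * mom θ 0 2 / y2 θ ^ 2

/-- The residual moments `m_k`, `k = 0, 2, 4, 6`. -/
noncomputable def resMom (θ : ℝ) (k : ℕ) : ℝ :=
  mom θ k 0 - weight1 θ * x1 θ ^ k - weight2 θ * x2 θ ^ k

noncomputable def weights (θ : ℝ) : Fin 4 → ℝ :=
  ![weight1 θ, weight2 θ, weight3 (resMom θ), weight4 (resMom θ)]

noncomputable def nodesX (θ : ℝ) : Fin 4 → ℝ :=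
  ![x1 θ, x2 θ, coord3 (resMom θ), coord4 (resMom θ)]

noncomputable def nodesY (θ : ℝ) : Fin 4 → ℝ := ![y1 θ, y2 θ, 0, 0]

end Neg

/-! #### The formulas for `θ ∈ [0,1]` -/

namespace Pos

noncomputable def beta1 (θ : ℝ) : ℝ :=
  1 - mom θ 2 2 ^ 2 / (mom θ 2 4 * mom θ 2 0) + (√30 + 2) / 36 * θ ^ 2

noncomputable def beta2 (θ : ℝ) : ℝ := mom θ 6 0 * mom θ 2 0 - mom θ 4 0 ^ 2

noncomputable def beta3 (θ : ℝ) : ℝ := mom θ 2 4 * mom θ 2 0 - mom θ 2 2 ^ 2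

noncomputable def x1 (θ : ℝ) : ℝ :=
  √((mom θ 4 0 + √((1 - beta1 θ) * beta2 θ / beta1 θ)) / mom θ 2 0)

noncomputable def y1 (θ : ℝ) : ℝ :=
  √((mom θ 2 2 - √((1 - beta1 θ) * beta3 θ / beta1 θ)) / mom θ 2 0)

noncomputable def weight1 (θ : ℝ) : ℝ := beta1 θ * mom θ 2 0 / x1 θ ^ 2

noncomputable def x2 (θ : ℝ) : ℝ :=
  √((mom θ 4 0 - √(beta1 θ * beta2 θ / (1 - beta1 θ))) / mom θ 2 0)

noncomputable def y2 (θ : ℝ) : ℝ :=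
  √((mom θ 2 2 + √(beta1 θ * beta3 θ / (1 - beta1 θ))) / mom θ 2 0)

noncomputable def weight2 (θ : ℝ) : ℝ := (1 - beta1 θ) * mom θ 2 0 / x2 θ ^ 2

/-- The residual moments `m_k`, `k = 0, 2, 4, 6`. -/
noncomputable def resMom (θ : ℝ) (k : ℕ) : ℝ :=
  mom θ 0 k - weight1 θ * y1 θ ^ k - weight2 θ * y2 θ ^ k

noncomputable def weights (θ : ℝ) : Fin 4 → ℝ :=
  ![weight1 θ, weight2 θ, weight3 (resMom θ), weight4 (resMom θ)]

noncomputable def nodesX (θ : ℝ) : Fin 4 → ℝ := ![x1 θ, x2 θ, 0, 0]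

noncomputable def nodesY (θ : ℝ) : Fin 4 → ℝ :=
  ![y1 θ, y2 θ, coord3 (resMom θ), coord4 (resMom θ)]

end Pos

end OCAD

/-! ### Averages as linear functionals: moments and positivity. -/

namespace OCAD

open MeasureTheory intervalIntegral

/-! Optimality is linear-programming duality. Applying a symmetric CAD to a polynomial `p ≥ 0` and
dropping the interior sum gives `w * bdry θ p ≤ avg p`, with equality when `p` vanishes at all
nodes. So it suffices that the explicit rule is a CAD and that some nonzero cubic `q` vanishes at
its nodes: then `q ^ 2` is critical, and the optimal weight, both infima and the smallest root of
the pencil all equal `wStar θ` (`optimal_of_cubic_vanishing`).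

Take `θ ≤ 0`. The form `avg (q ^ 2) - φ * bdry θ (q ^ 2)` splits by parity, and on the span of `y,
x²y, y³` its determinant is a cubic in `1/φ`; `wStar θ` comes from the largest root of that cubic,
in trigonometric form (`trigRoot_spec`). The kernel is spanned by `y (κ x² + y² - η)`, so the nodes
must lie on the axis `y = 0` or on the curve `y² = η - κ x²`, which is a line in `X = x²`, `Y = y²`.

For feasibility, put the first two orbits on that line. Weighted by `y²`, they must reproduce three
moments in `X`; this leaves one free parameter, `β₁`. The kernel relations (`row_one`, `row_two`,
`row_three`) then give the other moments containing `y` (`Neg.moment_eq`). The remaining moments in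
`X` are supplied by a two-point Gauss rule on the axis (`twoPoint_gauss`), provided that they
satisfy the Hankel inequalities on `[0, 1]` (`residual_moments`).

After rescaling, everything lives on an algebraic curve in `(P, Q)`, and the inequalities reduce to
polynomial inequalities in `P ∈ [0, 1]`, certified in Bernstein bases. The delicate one is `m₂² ≤ m₁
m₃`, an equality at `θ = 0`: its slack is of order `1 - P`, and the `θ²` term in `β₁` keeps the
product of the first two abscissae of order `(1 - P)²`. The case `θ ≥ 0` follows by exchanging `x`
and `y`. -/

theorem continuous_val_comp (p : Poly) {X : Type*} [TopologicalSpace X] {f g : X → ℝ}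
    (hf : Continuous f) (hg : Continuous g) : Continuous fun z => val p (f z) (g z) := by
  unfold val
  refine (MvPolynomial.continuous_eval p).comp (continuous_pi fun i => ?_)
  fin_cases i
  · exact hf
  · exact hg

theorem continuous_val_left (p : Poly) (y : ℝ) : Continuous fun x => val p x y :=
  continuous_val_comp p continuous_id continuous_const

theorem continuous_val_right (p : Poly) (x : ℝ) : Continuous fun y => val p x y :=
  continuous_val_comp p continuous_const continuous_id

theorem continuous_integral_val (p : Poly) :
    Continuous fun x => ∫ y in (-1 : ℝ)..1, val p x y :=
  continuous_parametric_intervalIntegral_of_continuous'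
    (continuous_val_comp p continuous_fst continuous_snd) _ _

theorem val_add (p q : Poly) (x y : ℝ) : val (p + q) x y = val p x y + val q x y := by
  simp [val]

theorem val_smul (c : ℝ) (p : Poly) (x y : ℝ) : val (c • p) x y = c * val p x y := by
  simp [val]

theorem val_pow (p : Poly) (n : ℕ) (x y : ℝ) : val (p ^ n) x y = val p x y ^ n := by
  simp [val]

theorem val_monomial (m : Fin 2 →₀ ℕ) (c x y : ℝ) :
    val (MvPolynomial.monomial m c) x y = c * (x ^ m 0 * y ^ m 1) := by
  simp [val, MvPolynomial.eval_monomial, Finsupp.prod_fintype, Fin.prod_univ_two]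

/-- The cell average as a linear functional. -/
noncomputable def avgLin : Poly →ₗ[ℝ] ℝ where
  toFun := avg
  map_add' p q := by
    simp only [avg, val_add]
    have h : ∀ x, ∫ y in (-1 : ℝ)..1, (val p x y + val q x y) =
        (∫ y in (-1 : ℝ)..1, val p x y) + ∫ y in (-1 : ℝ)..1, val q x y := fun x =>
      integral_add ((continuous_val_right p x).intervalIntegrable _ _)
        ((continuous_val_right q x).intervalIntegrable _ _)
    simp only [h]
    rw [integral_add ((continuous_integral_val p).intervalIntegrable _ _)
      ((continuous_integral_val q).intervalIntegrable _ _)]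
    ring
  map_smul' c p := by
    simp only [avg, val_smul, intervalIntegral.integral_const_mul, RingHom.id_apply, smul_eq_mul]
    ring

/-- The average over the edges `x = ±1` as a linear functional. -/
noncomputable def avgXLin : Poly →ₗ[ℝ] ℝ where
  toFun := avgX
  map_add' p q := by
    simp only [avgX, val_add]
    rw [integral_add ((continuous_val_right p _).intervalIntegrable _ _)
        ((continuous_val_right q _).intervalIntegrable _ _),
      integral_add ((continuous_val_right p _).intervalIntegrable _ _)
        ((continuous_val_right q _).intervalIntegrable _ _)]
    ring
  map_smul' c p := by
    simp only [avgX, val_smul, intervalIntegral.integral_const_mul, RingHom.id_apply, smul_eq_mul]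
    ring

/-- The average over the edges `y = ±1` as a linear functional. -/
noncomputable def avgYLin : Poly →ₗ[ℝ] ℝ where
  toFun := avgY
  map_add' p q := by
    simp only [avgY, val_add]
    rw [integral_add ((continuous_val_left p _).intervalIntegrable _ _)
        ((continuous_val_left q _).intervalIntegrable _ _),
      integral_add ((continuous_val_left p _).intervalIntegrable _ _)
        ((continuous_val_left q _).intervalIntegrable _ _)]
    ring
  map_smul' c p := by
    simp only [avgY, val_smul, intervalIntegral.integral_const_mul, RingHom.id_apply, smul_eq_mul]
    ring

/-- The mean over `(±x, ±y)` as a linear functional. -/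
noncomputable def symMeanLin (x y : ℝ) : Poly →ₗ[ℝ] ℝ where
  toFun p := symMean p x y
  map_add' p q := by simp only [symMean, val_add]; ring
  map_smul' c p := by
    simp only [symMean, val_smul, RingHom.id_apply, smul_eq_mul]; ring

/-- The boundary functional as a linear functional. -/
noncomputable def bdryLin (θ : ℝ) : Poly →ₗ[ℝ] ℝ := (1 + θ) • avgXLin + (1 - θ) • avgYLin

theorem bdryLin_apply (θ : ℝ) (p : Poly) : bdryLin θ p = bdry θ p := rfl

theorem avgLin_apply (p : Poly) : avgLin p = avg p := rfl

/-- `1` for even `n` and `0` for odd `n`. -/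
noncomputable def evenInd (n : ℕ) : ℝ := (1 + (-1) ^ n) / 2

theorem evenInd_odd {n : ℕ} (h : Odd n) : evenInd n = 0 := by simp [evenInd, h.neg_one_pow]

theorem integral_pow_symm (n : ℕ) :
    ∫ x in (-1 : ℝ)..1, x ^ n = 2 * (evenInd n / ((n : ℝ) + 1)) := by
  rw [integral_pow, evenInd, pow_succ]
  ring

theorem avg_monomial (m : Fin 2 →₀ ℕ) (c : ℝ) : avg (MvPolynomial.monomial m c) =
    c * (evenInd (m 0) * evenInd (m 1)) * (1 / (((m 0 : ℝ) + 1) * ((m 1 : ℝ) + 1))) := by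
  simp only [avg, val_monomial, intervalIntegral.integral_const_mul,
    intervalIntegral.integral_mul_const, integral_pow_symm]
  field_simp
  ring

theorem avgX_monomial (m : Fin 2 →₀ ℕ) (c : ℝ) : avgX (MvPolynomial.monomial m c) =
    c * (evenInd (m 0) * evenInd (m 1)) * (1 / (1 + (m 1 : ℝ))) := by
  simp only [avgX, val_monomial, intervalIntegral.integral_const_mul, integral_pow_symm]
  rw [evenInd, evenInd, add_comm (1 : ℝ) (m 1 : ℝ)]
  field_simp
  ring

theorem avgY_monomial (m : Fin 2 →₀ ℕ) (c : ℝ) : avgY (MvPolynomial.monomial m c) =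
    c * (evenInd (m 0) * evenInd (m 1)) * (1 / (1 + (m 0 : ℝ))) := by
  simp only [avgY, val_monomial, intervalIntegral.integral_const_mul,
    intervalIntegral.integral_mul_const, integral_pow_symm]
  rw [evenInd, evenInd, add_comm (1 : ℝ) (m 0 : ℝ)]
  field_simp
  ring

theorem symMean_monomial (m : Fin 2 →₀ ℕ) (c x y : ℝ) :
    symMean (MvPolynomial.monomial m c) x y =
      c * (evenInd (m 0) * evenInd (m 1)) * (x ^ m 0 * y ^ m 1) := by
  simp only [symMean, val_monomial, evenInd]
  rw [neg_pow x, neg_pow y]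
  ring

/-- A decomposition is exact on `ℙ^k` once it reproduces the even moments of degree at most `k`. -/
theorem exact_of_moments {k : ℕ} {θ : ℝ} {S : ℕ} {ω x y : Fin S → ℝ}
    (h : ∀ i j : ℕ, 2 * i + 2 * j ≤ k →
      mom θ (2 * i) (2 * j) = ∑ s, ω s * (x s ^ (2 * i) * y s ^ (2 * j)))
    (p : Poly) (hp : p ∈ polySpace k) :
    avg p = wStar θ * bdry θ p + ∑ s, ω s * symMean p (x s) (y s) := by
  let F : Poly →ₗ[ℝ] ℝ := avgLin - wStar θ • bdryLin θ - ∑ s, ω s • symMeanLin (x s) (y s)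
  have hF : ∀ q : Poly, F q =
      avg q - wStar θ * bdry θ q - ∑ s, ω s * symMean q (x s) (y s) := by
    intro q
    simp only [F, LinearMap.sub_apply, LinearMap.smul_apply, LinearMap.sum_apply, smul_eq_mul,
      bdryLin_apply, avgLin_apply]
    rfl
  have hmon : ∀ (m : Fin 2 →₀ ℕ) (c : ℝ), m 0 + m 1 ≤ k → F (MvPolynomial.monomial m c) = 0 := by
    intro m c hm
    have hFm : F (MvPolynomial.monomial m c) = c * (evenInd (m 0) * evenInd (m 1)) *
        (mom θ (m 0) (m 1) - ∑ s, ω s * (x s ^ m 0 * y s ^ m 1)) := by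
      rw [hF, bdry, avg_monomial, avgX_monomial, avgY_monomial, mul_sub, Finset.mul_sum]
      simp only [symMean_monomial, mom]
      congr 1
      · ring
      · exact Finset.sum_congr rfl fun s _ => by ring
    rw [hFm]
    -- If an exponent is odd, every functional vanishes by symmetry; this is why degree 7 demands
    -- nothing beyond degree 6.
    rcases Nat.even_or_odd (m 0) with h0 | h0
    · rcases Nat.even_or_odd (m 1) with h1 | h1
      · obtain ⟨i, hi⟩ := h0.two_dvd
        obtain ⟨j, hj⟩ := h1.two_dvd
        rw [hi, hj, h i j (by omega), sub_self, mul_zero]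
      · rw [evenInd_odd h1]; ring
    · rw [evenInd_odd h0]; ring
  have hdeg : p.totalDegree ≤ k := (MvPolynomial.mem_restrictTotalDegree _ _ _).mp hp
  have hzero : F p = 0 := by
    rw [← MvPolynomial.support_sum_monomial_coeff p, map_sum]
    refine Finset.sum_eq_zero fun m hm => hmon m _ ?_
    have := (MvPolynomial.le_totalDegree hm).trans hdeg
    rwa [Finsupp.sum_fintype _ _ (fun _ => rfl), Fin.sum_univ_two] at this
  rw [hF] at hzero
  linarith

theorem bdry_nonneg {θ : ℝ} (hθ : θ ∈ Set.Icc (-1 : ℝ) 1) {p : Poly}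
    (hp : ∀ x ∈ Set.Icc (-1 : ℝ) 1, ∀ y ∈ Set.Icc (-1 : ℝ) 1, 0 ≤ val p x y) :
    0 ≤ bdry θ p := by
  have hl : (-1 : ℝ) ∈ Set.Icc (-1 : ℝ) 1 := by norm_num
  have hr : (1 : ℝ) ∈ Set.Icc (-1 : ℝ) 1 := by norm_num
  have hX : 0 ≤ avgX p := by
    have h1 := integral_nonneg (μ := volume) (by norm_num : (-1 : ℝ) ≤ 1) (hp _ hl)
    have h2 := integral_nonneg (μ := volume) (by norm_num : (-1 : ℝ) ≤ 1) (hp _ hr)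
    unfold avgX
    positivity
  have hY : 0 ≤ avgY p := by
    have h1 := integral_nonneg (μ := volume) (by norm_num : (-1 : ℝ) ≤ 1)
      (fun x hx => hp x hx _ hl)
    have h2 := integral_nonneg (μ := volume) (by norm_num : (-1 : ℝ) ≤ 1)
      (fun x hx => hp x hx _ hr)
    unfold avgY
    positivity
  exact add_nonneg (mul_nonneg (by linarith [hθ.1]) hX) (mul_nonneg (by linarith [hθ.2]) hY)

/-- A continuous nonnegative function with zero integral vanishes; this is used for the outer
integral and then for the inner one. A polynomial that vanishes on a product of infinite sets is
zero. -/
theorem eq_zero_of_avg_eq_zero {p : Poly}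
    (hp : ∀ x ∈ Set.Icc (-1 : ℝ) 1, ∀ y ∈ Set.Icc (-1 : ℝ) 1, 0 ≤ val p x y)
    (h : avg p = 0) : p = 0 := by
  have hnn : ∀ x ∈ Set.Icc (-1 : ℝ) 1, 0 ≤ ∫ y in (-1 : ℝ)..1, val p x y := fun x hx =>
    integral_nonneg (by norm_num) (hp x hx)
  have hout : ∀ x ∈ Set.Icc (-1 : ℝ) 1, ∫ y in (-1 : ℝ)..1, val p x y = 0 := by
    intro x hx
    by_contra hne
    have hpos := intervalIntegral.integral_pos (by norm_num : (-1 : ℝ) < 1)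
      (continuous_integral_val p).continuousOn
      (fun x hx => hnn x (Set.Ioc_subset_Icc_self hx))
      ⟨x, hx, lt_of_le_of_ne (hnn x hx) (Ne.symm hne)⟩
    unfold avg at h
    linarith
  have hin : ∀ x ∈ Set.Icc (-1 : ℝ) 1, ∀ y ∈ Set.Icc (-1 : ℝ) 1, val p x y = 0 := by
    intro x hx y hy
    by_contra hne
    have hpos := intervalIntegral.integral_pos (by norm_num : (-1 : ℝ) < 1)
      (continuous_val_right p x).continuousOn
      (fun y hy => hp x hx y (Set.Ioc_subset_Icc_self hy))
      ⟨y, hy, lt_of_le_of_ne (hp x hx y hy) (Ne.symm hne)⟩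
    exact hpos.ne' (hout x hx)
  refine MvPolynomial.funext_set (fun _ => Set.Icc (-1 : ℝ) 1)
    (fun _ => Set.Icc_infinite (by norm_num)) fun z hz => ?_
  have hz' : z = ![z 0, z 1] := by
    ext i; fin_cases i <;> rfl
  rw [map_zero, hz']
  exact hin _ (hz 0 trivial) _ (hz 1 trivial)

theorem val_sq_nonneg (q : Poly) (x y : ℝ) : 0 ≤ val (q ^ 2) x y := by
  rw [val_pow]; positivity

theorem avg_sq_pos {q : Poly} (hq : q ≠ 0) : 0 < avg (q ^ 2) := by
  have hnn : 0 ≤ avg (q ^ 2) := by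
    unfold avg
    refine mul_nonneg (by norm_num) (integral_nonneg (by norm_num) fun x _ =>
      integral_nonneg (by norm_num) fun y _ => val_sq_nonneg q x y)
  refine lt_of_le_of_ne hnn fun h => hq ?_
  exact pow_eq_zero_iff (two_ne_zero) |>.mp
    (eq_zero_of_avg_eq_zero (fun x _ y _ => val_sq_nonneg q x y) h.symm)

end OCAD

/-! ### Weak duality and complementary slackness. -/

namespace OCAD

open MeasureTheory intervalIntegral Matrix

theorem totalDegree_pow_mul_pow (i j : ℕ) :
    ((MvPolynomial.X 0 : Poly) ^ i * MvPolynomial.X 1 ^ j).totalDegree ≤ i + j := by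
  refine (MvPolynomial.totalDegree_mul _ _).trans (add_le_add ?_ ?_) <;>
    exact (MvPolynomial.totalDegree_pow _ _).trans (by rw [MvPolynomial.totalDegree_X, mul_one])

theorem pow_mul_pow_mem_polySpace {i j k : ℕ} (h : i + j ≤ k) :
    (MvPolynomial.X 0 : Poly) ^ i * MvPolynomial.X 1 ^ j ∈ polySpace k :=
  (MvPolynomial.mem_restrictTotalDegree _ _ _).mpr ((totalDegree_pow_mul_pow i j).trans h)

theorem cubicMonomials_mem (i : Fin 10) : cubicMonomials i ∈ polySpace 3 := by
  have h : ∀ a b : ℕ, a + b ≤ 3 → (MvPolynomial.X 0 : Poly) ^ a * MvPolynomial.X 1 ^ b ∈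
      polySpace 3 := fun a b => pow_mul_pow_mem_polySpace
  fin_cases i
  · simpa [cubicMonomials] using h 0 0
  · simpa [cubicMonomials] using h 1 0
  · simpa [cubicMonomials] using h 0 1
  · simpa [cubicMonomials] using h 2 0
  · simpa [cubicMonomials] using h 1 1
  · simpa [cubicMonomials] using h 0 2
  · simpa [cubicMonomials] using h 3 0
  · simpa [cubicMonomials] using h 2 1
  · simpa [cubicMonomials] using h 1 2
  · simpa [cubicMonomials] using h 0 3

/-- The cubic polynomial with coefficient vector `v`. -/
noncomputable def cubic (v : Fin 10 → ℝ) : Poly := ∑ i, v i • cubicMonomials i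

theorem cubic_mem (v : Fin 10 → ℝ) : cubic v ∈ polySpace 3 :=
  Submodule.sum_mem _ fun i _ => Submodule.smul_mem _ _ (cubicMonomials_mem i)

theorem val_cubic (v : Fin 10 → ℝ) (x y : ℝ) : val (cubic v) x y =
    v 0 + v 1 * x + v 2 * y + v 3 * x ^ 2 + v 4 * (x * y) + v 5 * y ^ 2 + v 6 * x ^ 3 +
      v 7 * (x ^ 2 * y) + v 8 * (x * y ^ 2) + v 9 * y ^ 3 := by
  simp [val, cubic, cubicMonomials, Fin.sum_univ_succ]
  ring

theorem cubic_ne_zero {v : Fin 10 → ℝ} (hv : v ≠ 0) : cubic v ≠ 0 := by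
  intro h
  have hval : ∀ x y : ℝ, v 0 + v 1 * x + v 2 * y + v 3 * x ^ 2 + v 4 * (x * y) + v 5 * y ^ 2 +
      v 6 * x ^ 3 + v 7 * (x ^ 2 * y) + v 8 * (x * y ^ 2) + v 9 * y ^ 3 = 0 := by
    intro x y
    rw [← val_cubic, h]
    simp [val]
  -- These ten points are unisolvent for cubics: four on each axis, sharing the origin, fix the pure
  -- powers, and three points `(±1, ±1)` fix the mixed terms.
  have h1 := hval 0 0
  have h2 := hval 1 0
  have h3 := hval (-1) 0
  have h4 := hval 2 0
  have h5 := hval 0 1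
  have h6 := hval 0 (-1)
  have h7 := hval 0 2
  have h8 := hval 1 1
  have h9 := hval (-1) 1
  have h10 := hval 1 (-1)
  norm_num at h1 h2 h3 h4 h5 h6 h7 h8 h9 h10
  refine hv (funext fun i => ?_)
  fin_cases i <;> simp only [Pi.zero_apply, Fin.zero_eta, Fin.mk_one, Fin.reduceFinMk] <;> linarith

theorem sq_mem_polySpace {q : Poly} (hq : q ∈ polySpace 3) {k : ℕ} (hk : 6 ≤ k) :
    q ^ 2 ∈ polySpace k := by
  have h3 := (MvPolynomial.mem_restrictTotalDegree _ _ _).mp hq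
  refine (MvPolynomial.mem_restrictTotalDegree _ _ _).mpr ?_
  have := MvPolynomial.totalDegree_pow q 2
  omega

theorem squares_subset_nonnegPart {k : ℕ} (hk : 6 ≤ k) :
    squares (polySpace 3) ⊆ nonnegPart (polySpace k) := by
  rintro p ⟨q, hq, rfl⟩
  exact ⟨sq_mem_polySpace hq hk, fun x _ y _ => val_sq_nonneg q x y⟩

theorem symMean_nonneg {p : Poly}
    (hp : ∀ x ∈ Set.Icc (-1 : ℝ) 1, ∀ y ∈ Set.Icc (-1 : ℝ) 1, 0 ≤ val p x y)
    {x y : ℝ} (hx : x ∈ Set.Icc (0 : ℝ) 1) (hy : y ∈ Set.Icc (0 : ℝ) 1) : 0 ≤ symMean p x y := by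
  have hx1 : x ∈ Set.Icc (-1 : ℝ) 1 := ⟨by linarith [hx.1], hx.2⟩
  have hy1 : y ∈ Set.Icc (-1 : ℝ) 1 := ⟨by linarith [hy.1], hy.2⟩
  have hx2 : -x ∈ Set.Icc (-1 : ℝ) 1 := ⟨by linarith [hx.2], by linarith [hx.1]⟩
  have hy2 : -y ∈ Set.Icc (-1 : ℝ) 1 := ⟨by linarith [hy.2], by linarith [hy.1]⟩
  have h1 := hp x hx1 y hy1
  have h2 := hp _ hx2 y hy1
  have h3 := hp x hx1 _ hy2
  have h4 := hp _ hx2 _ hy2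
  unfold symMean
  positivity

/-- Weak duality: the boundary weight of a symmetric CAD bounds `⟨p⟩_Ω` from below. -/
theorem IsSymmetricCAD.mul_bdry_le_avg {V : Submodule ℝ Poly} {θ w : ℝ} {S : ℕ}
    {ω x y : Fin S → ℝ} (h : IsSymmetricCAD V θ w ω x y) {p : Poly} (hp : p ∈ nonnegPart V) :
    w * bdry θ p ≤ avg p := by
  rw [h.exact p hp.1]
  have : 0 ≤ ∑ s, ω s * symMean p (x s) (y s) := Finset.sum_nonneg fun s _ =>
    mul_nonneg (h.weight_pos s).le (symMean_nonneg hp.2 (h.node_x s) (h.node_y s))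
  linarith

theorem le_phi {V : Submodule ℝ Poly} {θ w : ℝ} (hθ : θ ∈ Set.Icc (-1 : ℝ) 1)
    (h : ∀ p ∈ nonnegPart V, w * bdry θ p ≤ avg p) {p : Poly} (hp : p ∈ nonnegPart V) :
    (w : EReal) ≤ phi θ p := by
  unfold phi
  split_ifs with h0
  · exact le_top
  · have hb : 0 < bdry θ p := lt_of_le_of_ne (bdry_nonneg hθ hp.2) (Ne.symm h0)
    exact EReal.coe_le_coe_iff.mpr ((le_div_iff₀ hb).mpr (h p hp))

/-- Translates the matrix pencil into squares of cubics, so that weak duality becomes positive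
semidefiniteness at `φ = w`. -/
theorem quadraticForm_eq (θ φ : ℝ) (v : Fin 10 → ℝ) :
    v ⬝ᵥ ((massMatrix - φ • bdryMatrix θ) *ᵥ v) =
      avg (cubic v ^ 2) - φ * bdry θ (cubic v ^ 2) := by
  let F : Poly →ₗ[ℝ] ℝ := avgLin - φ • bdryLin θ
  have hM : ∀ i j, (massMatrix - φ • bdryMatrix θ) i j = F (cubicMonomials i * cubicMonomials j) := by
    intro i j
    simp only [massMatrix, bdryMatrix, Matrix.sub_apply, Matrix.smul_apply, Matrix.add_apply,
      Matrix.of_apply, smul_eq_mul, F, LinearMap.sub_apply, LinearMap.smul_apply]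
    rfl
  have hF : avg (cubic v ^ 2) - φ * bdry θ (cubic v ^ 2) = F (cubic v ^ 2) := rfl
  rw [hF, sq, cubic, Finset.sum_mul_sum, map_sum]
  simp only [dotProduct, mulVec, hM, Finset.mul_sum, map_sum, smul_mul_smul_comm, map_smul,
    smul_eq_mul]
  exact Finset.sum_congr rfl fun i _ => Finset.sum_congr rfl fun j _ => by ring

theorem isSymm_massMatrix_sub (θ φ : ℝ) : (massMatrix - φ • bdryMatrix θ).IsHermitian := by
  ext i j
  simp [massMatrix, bdryMatrix, mul_comm (cubicMonomials i)]

/-- Complementary slackness: a symmetric CAD whose nodes are zeros of a nonzero cubic is optimal,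
and all dual quantities agree with its boundary weight. -/
theorem optimal_of_cubic_vanishing {θ w : ℝ} (hθ : θ ∈ Set.Icc (-1 : ℝ) 1) {S : ℕ}
    {ω x y : Fin S → ℝ}
    (hcad : ∀ k : ℕ, k = 6 ∨ k = 7 → IsSymmetricCAD (polySpace k) θ w ω x y)
    {v : Fin 10 → ℝ} (hv : v ≠ 0) (hvan : ∀ s, symMean (cubic v ^ 2) (x s) (y s) = 0) :
    (∀ k : ℕ, k = 6 ∨ k = 7 → IsSymmetricOCAD (polySpace k) θ w ω x y) ∧
    (∀ k : ℕ, k = 6 ∨ k = 7 →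
      optimalWeight (polySpace k) θ = w ∧
      (optimalWeight (polySpace k) θ : EReal) = phiStar θ (nonnegPart (polySpace k)) ∧
      phiStar θ (nonnegPart (polySpace k)) = phiStar θ (squares (polySpace (k / 2))) ∧
      (∃ p, IsCriticalPositive (polySpace k) θ p) ∧
      (∃ q ∈ polySpace (k / 2), q ≠ 0 ∧ IsCriticalPositive (polySpace k) θ (q ^ 2))) ∧
    phiStar θ (squares (polySpace 3)) = (w : EReal) ∧
    IsLeast {φ : ℝ | (massMatrix - φ • bdryMatrix θ).det = 0} w := by
  have hq0 := cubic_ne_zero hv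
  have hpos := avg_sq_pos hq0
  have hq3 := cubic_mem v
  have heq : avg (cubic v ^ 2) = w * bdry θ (cubic v ^ 2) := by
    rw [(hcad 6 (.inl rfl)).exact _ (sq_mem_polySpace hq3 le_rfl)]
    simp [hvan]
  have hw : 0 < w := (hcad 6 (.inl rfl)).boundary_pos
  have hb : 0 < bdry θ (cubic v ^ 2) := pos_of_mul_pos_right (heq ▸ hpos) hw.le
  have hphi : phi θ (cubic v ^ 2) = w := by
    rw [phi, if_neg hb.ne', heq, mul_div_cancel_right₀ _ hb.ne']
  have hsix : ∀ {k : ℕ}, k = 6 ∨ k = 7 → 6 ≤ k := by rintro k (rfl | rfl) <;> norm_num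
  have hnn : ∀ k : ℕ, k = 6 ∨ k = 7 → cubic v ^ 2 ∈ nonnegPart (polySpace k) := fun k hk =>
    squares_subset_nonnegPart (hsix hk) ⟨_, hq3, rfl⟩
  have hmax : ∀ k : ℕ, k = 6 ∨ k = 7 → ∀ w' ∈ feasibleWeights (polySpace k) θ, w' ≤ w := by
    rintro k hk w' ⟨S', ω', x', y', h'⟩
    have := h'.mul_bdry_le_avg (hnn k hk)
    rw [heq] at this
    exact le_of_mul_le_mul_right this hb
  have hlow : ∀ k : ℕ, k = 6 ∨ k = 7 → ∀ p ∈ nonnegPart (polySpace k), (w : EReal) ≤ phi θ p :=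
    fun k hk p hp => le_phi hθ (fun p hp => (hcad k hk).mul_bdry_le_avg hp) hp
  have hstar : ∀ k : ℕ, k = 6 ∨ k = 7 → phiStar θ (nonnegPart (polySpace k)) = w := by
    intro k hk
    refine le_antisymm ?_ (le_iInf₂ (hlow k hk))
    rw [← hphi]
    exact iInf₂_le _ (hnn k hk)
  have hstar2 : phiStar θ (squares (polySpace 3)) = w := by
    refine le_antisymm ?_ (le_iInf₂ fun p hp => hlow 6 (.inl rfl) p
      (squares_subset_nonnegPart le_rfl hp))
    rw [← hphi]
    exact iInf₂_le _ ⟨_, hq3, rfl⟩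
  have hopt : ∀ k : ℕ, k = 6 ∨ k = 7 → optimalWeight (polySpace k) θ = w := fun k hk =>
    IsGreatest.csSup_eq ⟨⟨S, ω, x, y, hcad k hk⟩, hmax k hk⟩
  have hcrit : ∀ k : ℕ, k = 6 ∨ k = 7 → IsCriticalPositive (polySpace k) θ (cubic v ^ 2) :=
    fun k hk => ⟨hnn k hk, pow_ne_zero 2 hq0, by rw [hphi, hstar k hk]⟩
  have hhalf : ∀ {k : ℕ}, k = 6 ∨ k = 7 → k / 2 = 3 := by rintro k (rfl | rfl) <;> norm_num
  refine ⟨fun k hk => ⟨hcad k hk, hmax k hk⟩, fun k hk => ?_, hstar2, ?_, ?_⟩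
  · rw [hhalf hk, hopt k hk, hstar k hk, hstar2]
    exact ⟨rfl, rfl, rfl, ⟨_, hcrit k hk⟩, _, hq3, hq0, hcrit k hk⟩
  · have hform : ∀ u : Fin 10 → ℝ, 0 ≤ u ⬝ᵥ ((massMatrix - w • bdryMatrix θ) *ᵥ u) := by
      intro u
      rw [quadraticForm_eq]
      have := (hcad 6 (.inl rfl)).mul_bdry_le_avg
        (squares_subset_nonnegPart le_rfl ⟨_, cubic_mem u, rfl⟩)
      linarith
    have hpsd : (massMatrix - w • bdryMatrix θ).PosSemidef :=
      .of_dotProduct_mulVec_nonneg (isSymm_massMatrix_sub θ w) fun u => by simpa using hform u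
    -- A vector on which a positive semidefinite form is zero lies in the kernel of its matrix.
    refine Matrix.exists_mulVec_eq_zero_iff.mp ⟨v, hv, ?_⟩
    rw [← hpsd.dotProduct_mulVec_zero_iff, star_trivial, quadraticForm_eq, heq, sub_self]
  · intro φ hφ
    obtain ⟨u, hu, hker⟩ := Matrix.exists_mulVec_eq_zero_iff.mpr hφ
    have hz := quadraticForm_eq θ φ u
    rw [hker, dotProduct_zero] at hz
    have hmem := squares_subset_nonnegPart le_rfl ⟨_, cubic_mem u, rfl⟩
    have hle := (hcad 6 (.inl rfl)).mul_bdry_le_avg hmem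
    have hbu := bdry_nonneg hθ hmem.2
    have hau := avg_sq_pos (cubic_ne_zero hu)
    -- A root `φ < w` has a kernel cubic with average `φ` times its boundary value. Weak duality
    -- forces this boundary value to be zero, and then the average is zero, which is impossible for
    -- a nonzero square.
    by_contra! hlt
    rcases hbu.eq_or_lt with h0 | h0
    · rw [← h0] at hz
      linarith
    · linarith [mul_lt_mul_of_pos_right hlt h0]

end OCAD

/-! ### The trigonometric root. -/

namespace OCAD

/-- The largest root of `(Q - 4p)(Q - 7q)(Q + 3q) = 5p²(Q - 4q)`, `p = 1 - t`, `q = 1 + t`, in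
trigonometric form. -/
noncomputable def trigRoot (t : ℝ) : ℝ :=
  8 / 3 + 2 / 3 * √(126 * t ^ 2 + 96 * t + 94) * Real.cos (1 / 3 * Real.arccos
    ((864 * t ^ 3 + 2916 * t ^ 2 + 288 * t - 532) / (126 * t ^ 2 + 96 * t + 94) ^ (3 / 2 : ℝ)))

theorem wStar_eq (θ : ℝ) : wStar θ = (trigRoot |θ| + 4 + 2 * |θ|)⁻¹ := by
  rw [wStar, trigRoot, sq_abs]
  congr 1
  ring

theorem trigRoot_spec {t : ℝ} (h0 : 0 ≤ t) (h1 : t ≤ 1) :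
    (trigRoot t - 4 * (1 - t)) * (trigRoot t - 7 * (1 + t)) * (trigRoot t + 3 * (1 + t)) =
      5 * (1 - t) ^ 2 * (trigRoot t - 4 * (1 + t)) ∧
    8 / 3 + √(126 * t ^ 2 + 96 * t + 94) / 3 ≤ trigRoot t := by
  set D := 126 * t ^ 2 + 96 * t + 94 with hD
  set N := 864 * t ^ 3 + 2916 * t ^ 2 + 288 * t - 532 with hN
  have hDpos : 0 < D := by positivity
  have hrpow : D ^ (3 / 2 : ℝ) = √D ^ 3 := by
    rw [Real.sqrt_eq_rpow, ← Real.rpow_natCast, ← Real.rpow_mul hDpos.le]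
    norm_num
  have hs : 0 < √D := Real.sqrt_pos.mpr hDpos
  have hs2 : √D ^ 2 = D := Real.sq_sqrt hDpos.le
  -- The cubic has three real roots, so the argument of `arccos` lies in `[-1, 1]`.
  have hND : N ^ 2 ≤ (√D ^ 3) ^ 2 := by
    have hp : 0 ≤ 1 - t := by linarith
    have : (√D ^ 3) ^ 2 = D ^ 3 := by
      calc (√D ^ 3) ^ 2 = (√D ^ 2) ^ 3 := by ring
        _ = D ^ 3 := by rw [hs2]
    rw [this, hD, hN]
    nlinarith [mul_nonneg (pow_nonneg h0 3) hp, mul_nonneg (pow_nonneg h0 4) hp,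
      mul_nonneg (pow_nonneg h0 5) hp, pow_nonneg h0 6, pow_nonneg h0 3, pow_nonneg h0 2]
  have habs : |N| ≤ √D ^ 3 := abs_le_of_sq_le_sq hND (by positivity)
  set A := N / √D ^ 3 with hA
  have hA1 : -1 ≤ A ∧ A ≤ 1 := by
    rw [hA, le_div_iff₀ (by positivity), div_le_iff₀ (by positivity)]
    constructor <;> linarith [(abs_le.mp habs).1, (abs_le.mp habs).2]
  set c := Real.cos (1 / 3 * Real.arccos A) with hc
  have htriple : 4 * c ^ 3 - 3 * c = A := by
    rw [hc, ← Real.cos_three_mul, show 3 * (1 / 3 * Real.arccos A) = Real.arccos A by ring,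
      Real.cos_arccos hA1.1 hA1.2]
  -- An angle of at most `π / 3` selects the largest root.
  have hhalf : 1 / 2 ≤ c := by
    rw [hc, ← Real.cos_pi_div_three]
    refine Real.cos_le_cos_of_nonneg_of_le_pi ?_ ?_ ?_
    · have := Real.arccos_nonneg A
      positivity
    · linarith [Real.pi_pos]
    · linarith [Real.arccos_le_pi A]
  have hroot : trigRoot t = 8 / 3 + 2 / 3 * (√D * c) := by
    rw [trigRoot, ← hD, ← hN, hrpow, ← hA, ← hc, mul_assoc]
  -- The depressed cubic in `√D * c = 3/2 Q - 4`, obtained from the triple-angle identity.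
  have hy : 4 * (√D * c) ^ 3 - 3 * D * (√D * c) = N := by
    have : 4 * (√D * c) ^ 3 - 3 * D * (√D * c) = √D ^ 3 * (4 * c ^ 3 - 3 * c) := by
      nth_rw 2 [← hs2]; ring
    rw [this, htriple, hA, mul_div_cancel₀ _ (by positivity)]
  refine ⟨?_, ?_⟩
  · rw [hroot]
    rw [hD, hN] at hy
    linear_combination (2 / 27) * hy
  · rw [hroot]
    nlinarith

/-- The trigonometric root is at least `7(1 + t)`. -/
theorem seven_le_trigRoot {t : ℝ} (h0 : 0 ≤ t) (h1 : t ≤ 1) : 7 * (1 + t) ≤ trigRoot t := by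
  obtain ⟨hroot, hlow⟩ := trigRoot_spec h0 h1
  set Q := trigRoot t
  set s := √(126 * t ^ 2 + 96 * t + 94)
  have hs2 : s ^ 2 = 126 * t ^ 2 + 96 * t + 94 := Real.sq_sqrt (by positivity)
  have hs : 0 ≤ s := Real.sqrt_nonneg _
  by_contra! hlt
  -- The cubic `4y³ - 3s²y - N` is compared at `y = 3/2 Q - 4`, where it is zero, and at the point
  -- of `7 (1 + t)`, where it is nonpositive. It increases on `[s/2, ∞)`, which contains both points
  -- if `Q < 7 (1 + t)`.
  have hfac : (7 * (1 + t) - Q) * (4 * ((3 / 2 * Q - 4) ^ 2 + (3 / 2 * Q - 4) *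
      (21 / 2 * (1 + t) - 4) + (21 / 2 * (1 + t) - 4) ^ 2) - 3 * s ^ 2) =
      -(135 * (1 - t) ^ 2 * (1 + t)) := by
    rw [hs2]
    linear_combination (-9) * hroot
  have hspos : 0 < s := by nlinarith
  have hy : s / 2 ≤ 3 / 2 * Q - 4 := by linarith
  have hz : s / 2 < 21 / 2 * (1 + t) - 4 := by linarith
  have hpos : 0 < 4 * ((3 / 2 * Q - 4) ^ 2 + (3 / 2 * Q - 4) * (21 / 2 * (1 + t) - 4) +
      (21 / 2 * (1 + t) - 4) ^ 2) - 3 * s ^ 2 := by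
    nlinarith [mul_nonneg (sub_nonneg.mpr hy) (sub_nonneg.mpr hz.le),
      mul_nonneg hs (sub_nonneg.mpr hy), mul_pos hspos (sub_pos.mpr hz),
      sq_nonneg (3 / 2 * Q - 4 - s / 2), sq_nonneg (21 / 2 * (1 + t) - 4 - s / 2)]
  have h2 : 0 ≤ 135 * (1 - t) ^ 2 * (1 + t) := by positivity
  linarith [mul_pos (sub_pos.mpr hlt) hpos]

end OCAD

/-! ### The curve in `(P, Q)` and bounds for `Q`. -/

namespace OCAD

/-- The source of the numerical certificates: a polynomial in `P` with nonnegative coefficients in a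
Bernstein basis is nonnegative on `[0, 1]`. `linarith` finds the coefficients; raising the degree of
the basis makes tighter inequalities provable. -/
theorem bernstein_nonneg {P : ℝ} (h0 : 0 ≤ P) (h1 : P ≤ 1) (i j : ℕ) :
    0 ≤ P ^ i * (1 - P) ^ j :=
  mul_nonneg (pow_nonneg h0 i) (pow_nonneg (sub_nonneg.mpr h1) j)

/-- Eliminates a variable known only through an enclosure (`Q`, `hgt P Q` or the constant `c`): an
affine expression need only be checked at both ends. -/
theorem affine_nonneg {α β q l u : ℝ} (hl : l ≤ q) (hu : q ≤ u) (h1 : 0 ≤ α + β * l)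
    (h2 : 0 ≤ α + β * u) : 0 ≤ α + β * q := by
  rcases le_total 0 β with h | h
  · linarith [mul_le_mul_of_nonneg_left hl h]
  · linarith [mul_le_mul_of_nonpos_left hu h]

/-- The curve of pairs `P = (1 - t) / (1 + t)`, `Q = (1 / wStar - 4 - 2t) / (1 + t)`. -/
structure OnCurve (P Q : ℝ) : Prop where
  nonneg : 0 ≤ P
  le_one : P ≤ 1
  seven_le : 7 ≤ Q
  eq : (Q - 4 * P) * (Q - 7) * (Q + 3) = 5 * P ^ 2 * (Q - 4)

namespace OnCurve

variable {P Q : ℝ}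

/-- The second factor is positive for `R ≥ 7` (`slope_pos`), so the sign of the cubic at a trial
value `R` tells on which side of `Q` it lies. -/
theorem sub_eq (h : OnCurve P Q) (R : ℝ) :
    (R - 4 * P) * (R - 7) * (R + 3) - 5 * P ^ 2 * (R - 4) =
      (R - Q) * (R ^ 2 + Q * R + Q ^ 2 - (4 + 4 * P) * (Q + R) + 16 * P - 21 - 5 * P ^ 2) := by
  linear_combination h.eq

theorem slope_pos (h : OnCurve P Q) {R : ℝ} (hR : 7 ≤ R) :
    0 < R ^ 2 + Q * R + Q ^ 2 - (4 + 4 * P) * (Q + R) + 16 * P - 21 - 5 * P ^ 2 := by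
  obtain ⟨h0, h1, h7, -⟩ := h
  nlinarith [mul_nonneg (sub_nonneg.mpr h7) (sub_nonneg.mpr hR), mul_nonneg h0 (sub_nonneg.mpr h1),
    mul_nonneg (sub_nonneg.mpr h1) (sub_nonneg.mpr hR),
    mul_nonneg (sub_nonneg.mpr h1) (sub_nonneg.mpr h7), sq_nonneg (Q - 7), sq_nonneg (R - 7)]

/-- The bounds here and in `upper` enclose the expansion `Q = 7 + (3/14) P² + ⋯` at `P = 0`. At the
trial value `7 + P² ψ` the cubic is `P²` times the expression in `key`. -/
theorem lower (h : OnCurve P Q) :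
    7 + P ^ 2 * (0.214 + 0.1 * P + 0.14 * P ^ 2) ≤ Q := by
  have B := bernstein_nonneg h.nonneg h.le_one
  have h0 := h.nonneg
  set ψ := 0.214 + 0.1 * P + 0.14 * P ^ 2 with hψ
  have key : 0 ≤ -((7 + P ^ 2 * ψ - 4 * P) * ψ * (10 + P ^ 2 * ψ) - 5 * (3 + P ^ 2 * ψ)) := by
    rw [hψ]
    linarith [B 0 10, B 1 9, B 2 8, B 3 7, B 4 6, B 5 5, B 6 4, B 7 3, B 8 2, B 9 1, B 10 0]
  have hs := h.slope_pos (R := 7 + P ^ 2 * ψ) (by have : 0 ≤ ψ := by positivity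
                                                  nlinarith [sq_nonneg P])
  have heq := h.sub_eq (7 + P ^ 2 * ψ)
  by_contra! hlt
  nlinarith [mul_pos (sub_pos.mpr hlt) hs, mul_nonneg (sq_nonneg P) key]

theorem upper (h : OnCurve P Q) :
    Q ≤ 7 + P ^ 2 * (0.215 + 0.11 * P + 0.155 * P ^ 2) := by
  have B := bernstein_nonneg h.nonneg h.le_one
  have h0 := h.nonneg
  set ψ := 0.215 + 0.11 * P + 0.155 * P ^ 2 with hψ
  have key : 0 ≤ (7 + P ^ 2 * ψ - 4 * P) * ψ * (10 + P ^ 2 * ψ) - 5 * (3 + P ^ 2 * ψ) := by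
    rw [hψ]
    linarith [B 0 27, B 1 26, B 2 25, B 3 24, B 4 23, B 5 22, B 6 21, B 7 20, B 8 19, B 9 18, B 10 17, B 11 16, B 12 15, B 13 14, B 14 13, B 15 12, B 16 11, B 17 10, B 18 9, B 19 8, B 20 7, B 21 6, B 22 5, B 23 4, B 24 3, B 25 2, B 26 1, B 27 0]
  have hs := h.slope_pos (R := 7 + P ^ 2 * ψ) (by have : 0 ≤ ψ := by positivity
                                                  nlinarith [sq_nonneg P])
  have heq := h.sub_eq (7 + P ^ 2 * ψ)
  by_contra! hlt
  nlinarith [mul_pos (sub_pos.mpr hlt) hs, mul_nonneg (sq_nonneg P) key]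

/-- At `P = 1` the curve gives `Q = 2 + √30 ≈ 7.477`, and the bound of `upper` is exactly `7.48`. -/
theorem le_box (h : OnCurve P Q) : Q ≤ 7.48 := by
  have B := bernstein_nonneg h.nonneg h.le_one
  linarith [h.upper, B 0 4, B 1 3, B 2 2, B 3 1, B 4 0]

end OnCurve
end OCAD

/-! ### The kernel cubic and the line through the first two nodes. -/

namespace OCAD

/-- The slope of the line `Y = hgt - kap X` through the first two nodes `(x², y²)`. -/
noncomputable def kap (P Q : ℝ) : ℝ := 9 * P / ((Q - 5 * P) * (Q + P))

/-- The height of the line `Y = hgt - kap X` through the first two nodes `(x², y²)`. -/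
noncomputable def hgt (P Q : ℝ) : ℝ := 3 * ((Q - 2) / 5 + kap P Q * ((Q - 2 * P) / 9)) / Q

namespace OnCurve

variable {P Q : ℝ}

theorem prod_pos (h : OnCurve P Q) : 0 < (Q - 5 * P) * (Q + P) :=
  mul_pos (by linarith [h.seven_le, h.le_one]) (by linarith [h.seven_le, h.nonneg])

theorem kap_mul (h : OnCurve P Q) : kap P Q * ((Q - 5 * P) * (Q + P)) = 9 * P :=
  div_mul_cancel₀ _ h.prod_pos.ne'

/-- The three rows say that the coefficients of `y³ + κ x²y - η y` annihilate the moment matrix of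
`y, x²y, y³`. Two rows determine `κ` and `η`; the third holds because `(P, Q)` lies on the curve. -/
theorem row_one (h : OnCurve P Q) :
    hgt P Q * (Q / 3) = (Q - 2) / 5 + kap P Q * ((Q - 2 * P) / 9) := by
  have : Q ≠ 0 := by linarith [h.seven_le]
  rw [hgt]
  field_simp

theorem row_two (h : OnCurve P Q) :
    hgt P Q * ((Q - 2 * P) / 9) = kap P Q * ((Q - 4 * P) / 15) + (Q - 2 * P - 2) / 15 := by
  have hQ : Q ≠ 0 := by linarith [h.seven_le]
  have h1 := h.row_one
  have h2 := h.kap_mul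
  refine mul_left_cancel₀ hQ ?_
  linear_combination ((Q - 2 * P) / 3) * h1 - (4 / 135) * h2

theorem row_three (h : OnCurve P Q) :
    hgt P Q * ((Q - 2) / 5) = kap P Q * ((Q - 2 * P - 2) / 15) + (Q - 4) / 7 := by
  have h1 := h.row_one
  have h2 := h.kap_mul
  have hK := h.prod_pos
  refine mul_left_cancel₀ (mul_pos (by linarith [h.seven_le] : 0 < Q) hK).ne' ?_
  linear_combination (3 / 5 * (Q - 2) * ((Q - 5 * P) * (Q + P))) * h1 +
    (4 / 15 * P) * h2 - (4 / 175 * Q) * h.eq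

/-- This and the next three bounds are numerical enclosures around the values at `P = 0`, namely
`kap / P → 9/49` and `hgt = 3/7`. -/
theorem kap_lower (h : OnCurve P Q) :
    P * (0.1835 + 0.105 * P + 0.04 * P ^ 2 + 0.09 * P ^ 3) ≤ kap P Q := by
  have B := bernstein_nonneg h.nonneg h.le_one
  have h0 := h.nonneg
  rw [kap, le_div_iff₀ h.prod_pos]
  set φ := 0.1835 + 0.105 * P + 0.04 * P ^ 2 + 0.09 * P ^ 3 with hφ
  have hφ0 : 0 ≤ φ := by positivity
  set R := (7 + P ^ 2 * (0.215 + 0.11 * P + 0.155 * P ^ 2)) with hR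
  have key : 0 ≤ 9 - φ * (R ^ 2 - 4 * P * R - 5 * P ^ 2) := by
    rw [hφ, hR]
    linarith [B 0 11, B 1 10, B 2 9, B 3 8, B 4 7, B 5 6, B 6 5, B 7 4, B 8 3, B 9 2, B 10 1, B 11 0]
  have hK : (Q - 5 * P) * (Q + P) ≤ R ^ 2 - 4 * P * R - 5 * P ^ 2 := by
    nlinarith [h.upper, h.seven_le, h.le_one]
  nlinarith [mul_le_mul_of_nonneg_left hK hφ0]

theorem kap_upper (h : OnCurve P Q) :
    kap P Q ≤ P * (0.184 + 0.112 * P + 0.036 * P ^ 2 + 0.104 * P ^ 3) := by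
  have B := bernstein_nonneg h.nonneg h.le_one
  have h0 := h.nonneg
  rw [kap, div_le_iff₀ h.prod_pos]
  set φ := 0.184 + 0.112 * P + 0.036 * P ^ 2 + 0.104 * P ^ 3 with hφ
  have hφ0 : 0 ≤ φ := by positivity
  set R := (7 + P ^ 2 * (0.214 + 0.1 * P + 0.14 * P ^ 2)) with hR
  have key : 0 ≤ φ * (R ^ 2 - 4 * P * R - 5 * P ^ 2) - 9 := by
    rw [hφ, hR]
    linarith [B 0 11, B 1 10, B 2 9, B 3 8, B 4 7, B 5 6, B 6 5, B 7 4, B 8 3, B 9 2, B 10 1, B 11 0]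
  have hR7 : 7 ≤ R := by
    have : 0 ≤ P ^ 2 * (0.214 + 0.1 * P + 0.14 * P ^ 2) := by positivity
    linarith
  have hK : R ^ 2 - 4 * P * R - 5 * P ^ 2 ≤ (Q - 5 * P) * (Q + P) := by
    nlinarith [h.lower, h.seven_le, h.le_one]
  nlinarith [mul_le_mul_of_nonneg_left hK hφ0]

theorem hgt_lower (h : OnCurve P Q) :
    0.42757 + 0.0595 * P + 0.0104 * P ^ 2 + 0.0432 * P ^ 3 ≤ hgt P Q := by
  have B := bernstein_nonneg h.nonneg h.le_one
  have h7 := h.seven_le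
  have hx := affine_nonneg (q := Q)
    (α := P * (0.1835 + 0.105 * P + 0.04 * P ^ 2 + 0.09 * P ^ 3) * (-(2 * P) / 3) - 6 / 5)
    (β := P * (0.1835 + 0.105 * P + 0.04 * P ^ 2 + 0.09 * P ^ 3) / 3 -
      (0.42757 + 0.0595 * P + 0.0104 * P ^ 2 + 0.0432 * P ^ 3 - 3 / 5)) h.lower h.upper
    (by linarith [B 0 8, B 1 7, B 2 6, B 3 5, B 4 4, B 5 3, B 6 2, B 7 1, B 8 0])
    (by linarith [B 0 8, B 1 7, B 2 6, B 3 5, B 4 4, B 5 3, B 6 2, B 7 1, B 8 0])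
  have hk := mul_le_mul_of_nonneg_right h.kap_lower
    (by linarith [h.seven_le, h.le_one] : 0 ≤ Q - 2 * P)
  have h1 := h.row_one
  refine le_of_mul_le_mul_right ?_ (by linarith : 0 < Q / 3)
  linarith

theorem hgt_upper (h : OnCurve P Q) :
    hgt P Q ≤ 0.42957 + 0.063 * P + 0.0104 * P ^ 2 + 0.0432 * P ^ 3 := by
  have B := bernstein_nonneg h.nonneg h.le_one
  have h7 := h.seven_le
  have hx := affine_nonneg (q := Q)
    (α := 6 / 5 - P * (0.184 + 0.112 * P + 0.036 * P ^ 2 + 0.104 * P ^ 3) * (-(2 * P) / 3))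
    (β := (0.42957 + 0.063 * P + 0.0104 * P ^ 2 + 0.0432 * P ^ 3 - 3 / 5) -
      P * (0.184 + 0.112 * P + 0.036 * P ^ 2 + 0.104 * P ^ 3) / 3) h.lower h.upper
    (by linarith [B 0 8, B 1 7, B 2 6, B 3 5, B 4 4, B 5 3, B 6 2, B 7 1, B 8 0])
    (by linarith [B 0 8, B 1 7, B 2 6, B 3 5, B 4 4, B 5 3, B 6 2, B 7 1, B 8 0])
  have hk := mul_le_mul_of_nonneg_right h.kap_upper
    (by linarith [h.seven_le, h.le_one] : 0 ≤ Q - 2 * P)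
  have h1 := h.row_one
  refine le_of_mul_le_mul_right ?_ (by linarith : 0 < Q / 3)
  linarith

end OnCurve

end OCAD

/-! ### Moments of the line form. -/

namespace OCAD

/-- The moment of order `0` of the line form `hgt - kap X - Y` in the power of `X`. -/
noncomputable def lineMom0 (P Q : ℝ) : ℝ :=
  hgt P Q * (Q + 2) - kap P Q * ((Q - 2 * P + 2) / 3) - Q / 3

/-- The moment of order `1` of the line form `hgt - kap X - Y` in the power of `X`. -/
noncomputable def lineMom1 (P Q : ℝ) : ℝ :=
  hgt P Q * ((Q - 2 * P + 2) / 3) - kap P Q * ((Q - 4 * P + 2) / 5) - (Q - 2 * P) / 9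

/-- The moment of order `2` of the line form `hgt - kap X - Y` in the power of `X`. -/
noncomputable def lineMom2 (P Q : ℝ) : ℝ :=
  hgt P Q * ((Q - 4 * P + 2) / 5) - kap P Q * ((Q - 6 * P + 2) / 7) - (Q - 4 * P) / 15

namespace OnCurve

variable {P Q : ℝ}

theorem lineMom0_eq (h : OnCurve P Q) :
    lineMom0 P Q = 2 * hgt P Q - 2 / 3 * kap P Q + (4 * Q - 18) / 15 := by
  rw [lineMom0]
  linear_combination 3 * h.row_one

theorem lineMom1_eq (h : OnCurve P Q) :
    lineMom1 P Q = 2 / 3 * hgt P Q - 2 / 5 * kap P Q + 4 / 45 * (Q - 2 * P) - 2 / 5 := by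
  rw [lineMom1]
  linear_combination 3 * h.row_two

theorem lineMom0_lower (h : OnCurve P Q) : 1.5 + 0.05 * P ≤ lineMom0 P Q := by
  have B := bernstein_nonneg h.nonneg h.le_one
  rw [h.lineMom0_eq]
  linarith [h.hgt_lower, h.kap_upper, h.lower, B 0 6, B 1 5, B 2 4, B 3 3, B 4 2, B 5 1, B 6 0]

theorem lineMom1_lower (h : OnCurve P Q) : (0.5 - 0.24 * P) ≤ lineMom1 P Q := by
  have B := bernstein_nonneg h.nonneg h.le_one
  rw [h.lineMom1_eq]
  linarith [h.hgt_lower, h.kap_upper, h.lower, B 0 4, B 1 3, B 2 2, B 3 1, B 4 0]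

theorem lineMom1_upper (h : OnCurve P Q) : lineMom1 P Q ≤ (0.515 - 0.22 * P) := by
  have B := bernstein_nonneg h.nonneg h.le_one
  rw [h.lineMom1_eq]
  linarith [h.hgt_upper, h.kap_lower, h.upper, B 0 4, B 1 3, B 2 2, B 3 1, B 4 0]

theorem lineMom0_sub_lower (h : OnCurve P Q) :
    1.01 + 0.22 * P ≤ lineMom0 P Q - lineMom1 P Q := by
  have B := bernstein_nonneg h.nonneg h.le_one
  rw [h.lineMom0_eq, h.lineMom1_eq]
  linarith [h.hgt_lower, h.kap_upper, h.lower, B 0 4, B 1 3, B 2 2, B 3 1, B 4 0]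

theorem lineMom2_lower (h : OnCurve P Q) : (0.3 - 0.217 * P + 0.05 * P ^ 2) ≤ lineMom2 P Q := by
  have B := bernstein_nonneg h.nonneg h.le_one
  have hx := affine_nonneg (q := Q)
    (α := (0.42757 + 0.0595 * P + 0.0104 * P ^ 2 + 0.0432 * P ^ 3) * ((2 - 4 * P) / 5) - (P * (0.184 + 0.112 * P + 0.036 * P ^ 2 + 0.104 * P ^ 3)) * ((2 - 6 * P) / 7) + 4 * P / 15 - (0.3 - 0.217 * P + 0.05 * P ^ 2))
    (β := (0.42757 + 0.0595 * P + 0.0104 * P ^ 2 + 0.0432 * P ^ 3) / 5 - (P * (0.184 + 0.112 * P + 0.036 * P ^ 2 + 0.104 * P ^ 3)) / 7 - 1 / 15) h.lower h.upper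
    (by linarith [B 0 8, B 1 7, B 2 6, B 3 5, B 4 4, B 5 3, B 6 2, B 7 1, B 8 0])
    (by linarith [B 0 8, B 1 7, B 2 6, B 3 5, B 4 4, B 5 3, B 6 2, B 7 1, B 8 0])
  have h1 := mul_le_mul_of_nonneg_right h.hgt_lower
    (by linarith [h.seven_le, h.le_one] : 0 ≤ (Q - 4 * P + 2) / 5)
  have h2 := mul_le_mul_of_nonneg_right h.kap_upper
    (by linarith [h.seven_le, h.le_one] : 0 ≤ (Q - 6 * P + 2) / 7)
  rw [lineMom2]
  linarith

theorem lineMom2_upper (h : OnCurve P Q) : lineMom2 P Q ≤ (0.317 - 0.155 * P) := by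
  have B := bernstein_nonneg h.nonneg h.le_one
  have hx := affine_nonneg (q := Q)
    (α := (0.317 - 0.155 * P) - ((0.42957 + 0.063 * P + 0.0104 * P ^ 2 + 0.0432 * P ^ 3) * ((2 - 4 * P) / 5) - (P * (0.1835 + 0.105 * P + 0.04 * P ^ 2 + 0.09 * P ^ 3)) * ((2 - 6 * P) / 7) + 4 * P / 15))
    (β := 1 / 15 + (P * (0.1835 + 0.105 * P + 0.04 * P ^ 2 + 0.09 * P ^ 3)) / 7 - (0.42957 + 0.063 * P + 0.0104 * P ^ 2 + 0.0432 * P ^ 3) / 5) h.lower h.upper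
    (by linarith [B 0 8, B 1 7, B 2 6, B 3 5, B 4 4, B 5 3, B 6 2, B 7 1, B 8 0])
    (by linarith [B 0 8, B 1 7, B 2 6, B 3 5, B 4 4, B 5 3, B 6 2, B 7 1, B 8 0])
  have h1 := mul_le_mul_of_nonneg_right h.hgt_upper
    (by linarith [h.seven_le, h.le_one] : 0 ≤ (Q - 4 * P + 2) / 5)
  have h2 := mul_le_mul_of_nonneg_right h.kap_lower
    (by linarith [h.seven_le, h.le_one] : 0 ≤ (Q - 6 * P + 2) / 7)
  rw [lineMom2]
  linarith

theorem lineMom1_sub_upper (h : OnCurve P Q) : lineMom1 P Q - lineMom2 P Q ≤ (0.207 - 0.02 * P) := by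
  have B := bernstein_nonneg h.nonneg h.le_one
  have hx := affine_nonneg (q := Q)
    (α := (0.207 - 0.02 * P) - ((0.42757 + 0.0595 * P + 0.0104 * P ^ 2 + 0.0432 * P ^ 3) * ((4 + 12 * P) / 15) + (P * (0.184 + 0.112 * P + 0.036 * P ^ 2 + 0.104 * P ^ 3)) * ((-30 * P - 4) / 35) - 4 * P / 9 - 2 / 5))
    (β := (0.42757 + 0.0595 * P + 0.0104 * P ^ 2 + 0.0432 * P ^ 3) / 5 - (P * (0.184 + 0.112 * P + 0.036 * P ^ 2 + 0.104 * P ^ 3)) / 7 - 7 / 45) h.lower h.upper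
    (by linarith [B 0 10, B 1 9, B 2 8, B 3 7, B 4 6, B 5 5, B 6 4, B 7 3, B 8 2, B 9 1, B 10 0])
    (by linarith [B 0 10, B 1 9, B 2 8, B 3 7, B 4 6, B 5 5, B 6 4, B 7 3, B 8 2, B 9 1, B 10 0])
  have h1 := mul_le_mul_of_nonneg_right h.hgt_lower
    (by linarith [h.seven_le, h.le_one] : 0 ≤ (3 * Q - 12 * P - 4) / 15)
  have h2 := mul_le_mul_of_nonneg_right h.kap_upper
    (by linarith [h.seven_le, h.le_one] : 0 ≤ (5 * Q - 30 * P - 4) / 35)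
  rw [h.lineMom1_eq, lineMom2]
  linarith

theorem lineMom1_sub_lower (h : OnCurve P Q) : 0.1 ≤ lineMom1 P Q - lineMom2 P Q := by
  have B := bernstein_nonneg h.nonneg h.le_one
  have hx := affine_nonneg (q := Q)
    (α := (0.42957 + 0.063 * P + 0.0104 * P ^ 2 + 0.0432 * P ^ 3) * ((4 + 12 * P) / 15) + (P * (0.1835 + 0.105 * P + 0.04 * P ^ 2 + 0.09 * P ^ 3)) * ((-30 * P - 4) / 35) - 4 * P / 9 - 2 / 5 - 0.1)
    (β := 7 / 45 + (P * (0.1835 + 0.105 * P + 0.04 * P ^ 2 + 0.09 * P ^ 3)) / 7 - (0.42957 + 0.063 * P + 0.0104 * P ^ 2 + 0.0432 * P ^ 3) / 5) h.lower h.upper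
    (by linarith [B 0 8, B 1 7, B 2 6, B 3 5, B 4 4, B 5 3, B 6 2, B 7 1, B 8 0])
    (by linarith [B 0 8, B 1 7, B 2 6, B 3 5, B 4 4, B 5 3, B 6 2, B 7 1, B 8 0])
  have h1 := mul_le_mul_of_nonneg_right h.hgt_upper
    (by linarith [h.seven_le, h.le_one] : 0 ≤ (3 * Q - 12 * P - 4) / 15)
  have h2 := mul_le_mul_of_nonneg_right h.kap_lower
    (by linarith [h.seven_le, h.le_one] : 0 ≤ (5 * Q - 30 * P - 4) / 35)
  rw [h.lineMom1_eq, lineMom2]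
  linarith

/-- Bounds `η (m₂ - m₃) = T₂ - (η - κ) m₃` from below once `m₃ ≤ 0.56 - 0.13 P` is known
(`residual_three_upper`), where `T₂ = lineMom2 P Q`. -/
theorem lineMom2_sub_lower (h : OnCurve P Q) :
    (0.0628 - 0.09 * P + 0.0885 * P ^ 2) ≤ lineMom2 P Q - (hgt P Q - kap P Q) * (0.56 - 0.13 * P) := by
  have B := bernstein_nonneg h.nonneg h.le_one
  have hx := affine_nonneg (q := Q)
    (α := (0.42757 + 0.0595 * P + 0.0104 * P ^ 2 + 0.0432 * P ^ 3) * ((2 - 4 * P) / 5 - (0.56 - 0.13 * P)) - (P * (0.184 + 0.112 * P + 0.036 * P ^ 2 + 0.104 * P ^ 3)) * ((2 - 6 * P) / 7 - (0.56 - 0.13 * P)) + 4 * P / 15 - (0.0628 - 0.09 * P + 0.0885 * P ^ 2))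
    (β := (0.42757 + 0.0595 * P + 0.0104 * P ^ 2 + 0.0432 * P ^ 3) / 5 - (P * (0.184 + 0.112 * P + 0.036 * P ^ 2 + 0.104 * P ^ 3)) / 7 - 1 / 15) h.lower h.upper
    (by linarith [B 0 15, B 1 14, B 2 13, B 3 12, B 4 11, B 5 10, B 6 9, B 7 8, B 8 7, B 9 6, B 10 5, B 11 4, B 12 3, B 13 2, B 14 1, B 15 0])
    (by linarith [B 0 15, B 1 14, B 2 13, B 3 12, B 4 11, B 5 10, B 6 9, B 7 8, B 8 7, B 9 6, B 10 5, B 11 4, B 12 3, B 13 2, B 14 1, B 15 0])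
  have h1 := mul_le_mul_of_nonneg_right h.hgt_lower
    (by linarith [h.seven_le, h.le_one] : 0 ≤ (Q - 4 * P + 2) / 5 - (0.56 - 0.13 * P))
  have h2 := mul_le_mul_of_nonneg_right h.kap_upper
    (by linarith [h.lower, B 0 4, B 1 3, B 2 2, B 3 1, B 4 0] : 0 ≤ (Q - 6 * P + 2) / 7 - (0.56 - 0.13 * P))
  rw [lineMom2]
  linarith

theorem kap_nonneg (h : OnCurve P Q) : 0 ≤ kap P Q := by
  have h0 := h.nonneg
  exact le_trans (by positivity) h.kap_lower

theorem kap_le (h : OnCurve P Q) : kap P Q ≤ 0.436 * P := by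
  have h0 := h.nonneg
  have h1 := h.le_one
  refine h.kap_upper.trans ?_
  rw [mul_comm]
  refine mul_le_mul_of_nonneg_right ?_ h0
  nlinarith [pow_le_one₀ h0 h1 (n := 2), pow_le_one₀ h0 h1 (n := 3)]

theorem hgt_ge (h : OnCurve P Q) : 0.427 ≤ hgt P Q := by
  have h0 := h.nonneg
  refine le_trans ?_ h.hgt_lower
  have : 0 ≤ 0.0595 * P + 0.0104 * P ^ 2 + 0.0432 * P ^ 3 := by positivity
  linarith

theorem hgt_le (h : OnCurve P Q) : hgt P Q ≤ 0.547 := by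
  have h0 := h.nonneg
  have h1 := h.le_one
  refine h.hgt_upper.trans ?_
  nlinarith [pow_le_one₀ h0 h1 (n := 2), pow_le_one₀ h0 h1 (n := 3)]

/-- This form, `tail_form` and `diff_form` are the coefficients of `η m₂`, `m₃` and `η (m₂ - m₃)` in
the Hankel determinants of the residual moments, once the relations `η mᵢ = Tᵢ + κ mᵢ₊₁` have been
substituted. -/
theorem head_form_lower (h : OnCurve P Q) :
    0.62 ≤ hgt P Q * lineMom0 P Q - kap P Q * lineMom1 P Q := by
  have B := bernstein_nonneg h.nonneg h.le_one
  have h0 := h.nonneg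
  have h1 := mul_le_mul h.hgt_lower h.lineMom0_lower (by positivity) (by linarith [h.hgt_ge])
  have h2 := mul_le_mul h.kap_upper h.lineMom1_upper
    (by linarith [h.lineMom1_lower, h.le_one]) (by positivity)
  linarith [B 0 5, B 1 4, B 2 3, B 3 2, B 4 1, B 5 0]

theorem tail_form_lower (h : OnCurve P Q) :
    0.01 ≤ hgt P Q * lineMom1 P Q - kap P Q * lineMom2 P Q := by
  have B := bernstein_nonneg h.nonneg h.le_one
  have h0 := h.nonneg
  have h1 := mul_le_mul h.hgt_lower h.lineMom1_lower (by linarith [h.le_one])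
    (by linarith [h.hgt_ge])
  have h2 := mul_le_mul h.kap_upper h.lineMom2_upper
    (by nlinarith [h.lineMom2_lower, h.le_one]) (by positivity)
  linarith [B 0 5, B 1 4, B 2 3, B 3 2, B 4 1, B 5 0]

theorem tail_form_upper (h : OnCurve P Q) :
    hgt P Q * lineMom1 P Q - kap P Q * lineMom2 P Q ≤ 0.227 - 0.12 * P := by
  have B := bernstein_nonneg h.nonneg h.le_one
  have h0 := h.nonneg
  have h1 := mul_le_mul h.hgt_upper h.lineMom1_upper (by linarith [h.lineMom1_lower, h.le_one])
    (by positivity)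
  have h2 := mul_le_mul h.kap_lower h.lineMom2_lower (by nlinarith [h.le_one]) h.kap_nonneg
  linarith [B 0 6, B 1 5, B 2 4, B 3 3, B 4 2, B 5 1, B 6 0]

theorem diff_form_lower (h : OnCurve P Q) :
    0.43 + 0.1 * P ≤ hgt P Q * (lineMom0 P Q - lineMom1 P Q) -
      kap P Q * (lineMom1 P Q - lineMom2 P Q) := by
  have B := bernstein_nonneg h.nonneg h.le_one
  have h0 := h.nonneg
  have h1 := mul_le_mul h.hgt_lower h.lineMom0_sub_lower (by positivity) (by linarith [h.hgt_ge])
  have h2 := mul_le_mul h.kap_upper h.lineMom1_sub_upper (by linarith [h.lineMom1_sub_lower])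
    (by positivity)
  linarith [B 0 5, B 1 4, B 2 3, B 3 2, B 4 1, B 5 0]

end OnCurve

end OCAD

/-! ### Abscissae of the first two orbits. -/

namespace OCAD

/-- The three hypotheses are the Bernstein coefficients of the quadratic on `[l, u]`; the middle one
is its polar form at `(l, u)`. -/
theorem quadratic_nonneg {α β γ q l u : ℝ} (hl : l ≤ q) (hu : q ≤ u)
    (h0 : 0 ≤ α + β * l + γ * l ^ 2) (h1 : 0 ≤ α + β * ((l + u) / 2) + γ * (l * u))
    (h2 : 0 ≤ α + β * u + γ * u ^ 2) : 0 ≤ α + β * q + γ * q ^ 2 := by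
  rcases hl.eq_or_lt with rfl | hlt
  · exact h0
  have hl' := sub_nonneg.mpr hl
  have hu' := sub_nonneg.mpr hu
  refine nonneg_of_mul_nonneg_right ?_ (pow_pos (sub_pos.mpr (hlt.trans_le hu)) 2)
  have := add_nonneg (add_nonneg (mul_nonneg (sq_nonneg (u - q)) h0)
    (mul_nonneg (mul_nonneg hl' hu') h1)) (add_nonneg (mul_nonneg (mul_nonneg hl' hu') h1)
    (mul_nonneg (sq_nonneg (q - l)) h2))
  linarith

namespace OnCurve

variable {P Q : ℝ}

/-- `ξ` and `X` are the abscissae `x²` of the first two node orbits. -/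
structure IsAbscissae (P Q ξ X : ℝ) : Prop where
  nonneg : 0 ≤ ξ
  lower : 0.105 * (1 - P) ^ 2 ≤ ξ * (1 + P) ^ 2
  upper : ξ * (1 + P) ^ 2 ≤ 0.125 * (1 - P) ^ 2
  eq : ((Q - 2 * P) / 9 - Q / 3 * ξ) * X = (Q - 4 * P) / 15 - (Q - 2 * P) / 9 * ξ

variable {ξ X : ℝ}

theorem xi_le (h : OnCurve P Q) (hx : IsAbscissae P Q ξ X) : ξ ≤ 0.125 * (1 - P) ^ 2 := by
  have h0 := h.nonneg
  have : ξ * 1 ≤ ξ * (1 + P) ^ 2 :=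
    mul_le_mul_of_nonneg_left (by nlinarith) hx.nonneg
  linarith [hx.upper]

theorem denom_pos (h : OnCurve P Q) (hx : IsAbscissae P Q ξ X) :
    0 < (Q - 2 * P) / 9 - Q / 3 * ξ := by
  have h1 := h.xi_le hx
  have h0 := h.nonneg
  nlinarith [h.seven_le, h.le_one, mul_nonneg h0 (by linarith [h.seven_le] : 0 ≤ Q - 7)]

theorem abscissa_le (h : OnCurve P Q) (hx : IsAbscissae P Q ξ X) : X ≤ 0.8 := by
  have h1 := h.xi_le hx
  have h2 : ξ ≤ 0.125 := by nlinarith [h.nonneg, h.le_one]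
  refine le_of_mul_le_mul_left ?_ (h.denom_pos hx)
  rw [hx.eq]
  have h3 : 0 < 0.8 * (Q / 3) - (Q - 2 * P) / 9 := by linarith [h.seven_le, h.nonneg]
  nlinarith [mul_le_mul_of_nonneg_right h2 h3.le, h.seven_le, h.nonneg]

/-- `X` is an increasing function of `ξ`, by positivity of `(Q - 5P)(Q + P)`, and its value at `ξ =
0` is the claimed bound. -/
theorem le_abscissa (h : OnCurve P Q) (hx : IsAbscissae P Q ξ X) :
    (Q - 4 * P) / 15 ≤ (Q - 2 * P) / 9 * X := by
  refine le_of_mul_le_mul_left ?_ (h.denom_pos hx)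
  have h1 : 0 ≤ ((Q - 5 * P) * (Q + P)) * ξ := mul_nonneg h.prod_pos.le hx.nonneg
  have h2 : ((Q - 2 * P) / 9 - Q / 3 * ξ) * ((Q - 2 * P) / 9 * X) =
      (Q - 2 * P) / 9 * ((Q - 4 * P) / 15 - (Q - 2 * P) / 9 * ξ) := by
    linear_combination (Q - 2 * P) / 9 * hx.eq
  rw [h2]
  linarith

theorem abscissa_pos (h : OnCurve P Q) (hx : IsAbscissae P Q ξ X) : 0 < X := by
  have h1 := h.le_abscissa hx
  have h2 : 0 < (Q - 4 * P) / 15 := by linarith [h.seven_le, h.le_one]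
  exact pos_of_mul_pos_right (h2.trans_le h1) (by linarith [h.seven_le, h.le_one])

theorem mul_abscissa_le (h : OnCurve P Q) (hx : IsAbscissae P Q ξ X) :
    ξ * X ≤ 0.1 * (1 - P) ^ 2 := by
  have h1 := mul_le_mul (h.xi_le hx) (h.abscissa_le hx) (h.abscissa_pos hx).le (by positivity)
  linarith

theorem le_mul_abscissa (h : OnCurve P Q) (hx : IsAbscissae P Q ξ X) :
    (0.056 - 0.18 * P + 0.1 * P ^ 2) ≤ ξ * X := by
  have B := bernstein_nonneg h.nonneg h.le_one
  have h0 := h.nonneg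
  have hb : 0 < (Q - 2 * P) / 9 := by linarith [h.seven_le, h.le_one]
  have he : 0 < (Q - 4 * P) / 15 := by linarith [h.seven_le, h.le_one]
  have hpos : 0 < (1 + P) ^ 2 * ((Q - 2 * P) / 9) := by positivity
  refine le_of_mul_le_mul_right ?_ hpos
  have h1 : ξ * (1 + P) ^ 2 * ((Q - 4 * P) / 15) ≤ ξ * (1 + P) ^ 2 * ((Q - 2 * P) / 9 * X) :=
    mul_le_mul_of_nonneg_left (h.le_abscissa hx) (mul_nonneg hx.nonneg (by positivity))
  have h2 := mul_le_mul_of_nonneg_right hx.lower he.le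
  have h3 := affine_nonneg (q := Q)
    (α := 0.105 * (1 - P) ^ 2 * (-(4 * P) / 15) + (0.056 - 0.18 * P + 0.1 * P ^ 2) * (1 + P) ^ 2 * (2 * P / 9))
    (β := 0.105 * (1 - P) ^ 2 / 15 - (0.056 - 0.18 * P + 0.1 * P ^ 2) * (1 + P) ^ 2 / 9) h.seven_le h.le_box
    (by linarith [B 0 17, B 1 16, B 2 15, B 3 14, B 4 13, B 5 12, B 6 11, B 7 10, B 8 9, B 9 8, B 10 7, B 11 6, B 12 5, B 13 4, B 14 3, B 15 2, B 16 1, B 17 0])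
    (by linarith [B 0 17, B 1 16, B 2 15, B 3 14, B 4 13, B 5 12, B 6 11, B 7 10, B 8 9, B 9 8, B 10 7, B 11 6, B 12 5, B 13 4, B 14 3, B 15 2, B 16 1, B 17 0])
  linarith

theorem cross_lower (h : OnCurve P Q) :
    (0.2 - 0.155 * P) ≤ 4 / 405 * ((Q - 5 * P) * (Q + P)) * hgt P Q -
      kap P Q * ((Q - 4 * P) / 15) * ((Q - 2 * P) / 9) := by
  have B := bernstein_nonneg h.nonneg h.le_one
  have h1 := mul_le_mul_of_nonneg_right h.hgt_lower h.prod_pos.le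
  have h2 := mul_le_mul_of_nonneg_right h.kap_upper
    (mul_nonneg (by linarith [h.seven_le, h.le_one] : 0 ≤ (Q - 4 * P) / 15)
      (by linarith [h.seven_le, h.le_one] : 0 ≤ (Q - 2 * P) / 9))
  have h3 := quadratic_nonneg (q := Q)
    (α := (0.42757 + 0.0595 * P + 0.0104 * P ^ 2 + 0.0432 * P ^ 3) * (-(20 * P ^ 2) / 405) - (P * (0.184 + 0.112 * P + 0.036 * P ^ 2 + 0.104 * P ^ 3)) * (8 * P ^ 2 / 135) - (0.2 - 0.155 * P))
    (β := (0.42757 + 0.0595 * P + 0.0104 * P ^ 2 + 0.0432 * P ^ 3) * (-(16 * P) / 405) + (P * (0.184 + 0.112 * P + 0.036 * P ^ 2 + 0.104 * P ^ 3)) * (6 * P / 135))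
    (γ := (0.42757 + 0.0595 * P + 0.0104 * P ^ 2 + 0.0432 * P ^ 3) * (4 / 405) - (P * (0.184 + 0.112 * P + 0.036 * P ^ 2 + 0.104 * P ^ 3)) / 135) h.lower h.upper
    (by linarith [B 0 12, B 1 11, B 2 10, B 3 9, B 4 8, B 5 7, B 6 6, B 7 5, B 8 4, B 9 3, B 10 2, B 11 1, B 12 0])
    (by linarith [B 0 12, B 1 11, B 2 10, B 3 9, B 4 8, B 5 7, B 6 6, B 7 5, B 8 4, B 9 3, B 10 2, B 11 1, B 12 0])
    (by linarith [B 0 12, B 1 11, B 2 10, B 3 9, B 4 8, B 5 7, B 6 6, B 7 5, B 8 4, B 9 3, B 10 2, B 11 1, B 12 0])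
  linarith

theorem cross_upper (h : OnCurve P Q) :
    4 / 405 * ((Q - 5 * P) * (Q + P)) * hgt P Q -
      kap P Q * ((Q - 4 * P) / 15) * ((Q - 2 * P) / 9) ≤ 0.212 - 0.14 * P := by
  have B := bernstein_nonneg h.nonneg h.le_one
  have h1 := mul_le_mul_of_nonneg_right h.hgt_upper h.prod_pos.le
  have h2 := mul_le_mul_of_nonneg_right h.kap_lower
    (mul_nonneg (by linarith [h.seven_le, h.le_one] : 0 ≤ (Q - 4 * P) / 15)
      (by linarith [h.seven_le, h.le_one] : 0 ≤ (Q - 2 * P) / 9))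
  have h3 := quadratic_nonneg (q := Q)
    (α := 0.212 - 0.14 * P - ((0.42957 + 0.063 * P + 0.0104 * P ^ 2 + 0.0432 * P ^ 3) * (-(20 * P ^ 2) / 405) - (P * (0.1835 + 0.105 * P + 0.04 * P ^ 2 + 0.09 * P ^ 3)) * (8 * P ^ 2 / 135)))
    (β := -((0.42957 + 0.063 * P + 0.0104 * P ^ 2 + 0.0432 * P ^ 3) * (-(16 * P) / 405) + (P * (0.1835 + 0.105 * P + 0.04 * P ^ 2 + 0.09 * P ^ 3)) * (6 * P / 135)))
    (γ := -((0.42957 + 0.063 * P + 0.0104 * P ^ 2 + 0.0432 * P ^ 3) * (4 / 405) - (P * (0.1835 + 0.105 * P + 0.04 * P ^ 2 + 0.09 * P ^ 3)) / 135)) h.lower h.upper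
    (by linarith [B 0 12, B 1 11, B 2 10, B 3 9, B 4 8, B 5 7, B 6 6, B 7 5, B 8 4, B 9 3, B 10 2, B 11 1, B 12 0])
    (by linarith [B 0 12, B 1 11, B 2 10, B 3 9, B 4 8, B 5 7, B 6 6, B 7 5, B 8 4, B 9 3, B 10 2, B 11 1, B 12 0])
    (by linarith [B 0 12, B 1 11, B 2 10, B 3 9, B 4 8, B 5 7, B 6 6, B 7 5, B 8 4, B 9 3, B 10 2, B 11 1, B 12 0])
  linarith

/-- The part of the bound on `m₃` that is not covered by the product-free term of `third_moment`;
`excess_bound` absorbs it into the term proportional to `ξ X`. -/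
theorem excess_upper (h : OnCurve P Q) :
    ((Q - 6 * P + 2) / 7 - (0.56 - 0.13 * P)) * ((Q - 2 * P - 2) / 15) - ((Q - 4 * P) / 15) ^ 2 ≤ (0.0246 - 0.0885 * P + 0.0275 * P ^ 2) := by
  have B := bernstein_nonneg h.nonneg h.le_one
  have h3 := quadratic_nonneg (q := Q)
    (α := (0.0246 - 0.0885 * P + 0.0275 * P ^ 2) - ((2 - 6 * P) / 7 - (0.56 - 0.13 * P)) * ((-2 * P - 2) / 15) + 16 * P ^ 2 / 225)
    (β := -(((2 - 6 * P) / 7 - (0.56 - 0.13 * P)) / 15) - (-2 * P - 2) / 105 - 8 * P / 225)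
    (γ := 1 / 225 - 1 / 105) h.lower h.upper
    (by linarith [B 0 9, B 1 8, B 2 7, B 3 6, B 4 5, B 5 4, B 6 3, B 7 2, B 8 1, B 9 0])
    (by linarith [B 0 9, B 1 8, B 2 7, B 3 6, B 4 5, B 5 4, B 6 3, B 7 2, B 8 1, B 9 0])
    (by linarith [B 0 9, B 1 8, B 2 7, B 3 6, B 4 5, B 5 4, B 6 3, B 7 2, B 8 1, B 9 0])
  linarith

theorem excess_bound (h : OnCurve P Q) : hgt P Q * (0.0246 - 0.0885 * P + 0.0275 * P ^ 2) ≤ (0.056 - 0.18 * P + 0.1 * P ^ 2) * (0.2 - 0.155 * P) := by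
  have B := bernstein_nonneg h.nonneg h.le_one
  have h3 := affine_nonneg (q := hgt P Q) (α := (0.056 - 0.18 * P + 0.1 * P ^ 2) * (0.2 - 0.155 * P)) (β := -(0.0246 - 0.0885 * P + 0.0275 * P ^ 2)) h.hgt_lower h.hgt_upper
    (by linarith [B 0 20, B 1 19, B 2 18, B 3 17, B 4 16, B 5 15, B 6 14, B 7 13, B 8 12, B 9 11, B 10 10, B 11 9, B 12 8, B 13 7, B 14 6, B 15 5, B 16 4, B 17 3, B 18 2, B 19 1, B 20 0])
    (by linarith [B 0 20, B 1 19, B 2 18, B 3 17, B 4 16, B 5 15, B 6 14, B 7 13, B 8 12, B 9 11, B 10 10, B 11 9, B 12 8, B 13 7, B 14 6, B 15 5, B 16 4, B 17 3, B 18 2, B 19 1, B 20 0])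
  linarith

end OnCurve

end OCAD

/-! ### Positivity of the residual moments. -/

namespace OCAD

namespace OnCurve

variable {P Q ξ X s₀ s₁ s₂ s₃ : ℝ}

/-- `s₀, …, s₃` are the moments in `X = x²` of the first two node orbits. -/
structure IsAtomMoments (P Q ξ X s₀ s₁ s₂ s₃ : ℝ) : Prop where
  zero : hgt P Q * s₀ - kap P Q * s₁ = Q / 3
  one : hgt P Q * s₁ - kap P Q * s₂ = (Q - 2 * P) / 9
  two : hgt P Q * s₂ - kap P Q * s₃ = (Q - 4 * P) / 15
  recur : s₃ = (ξ + X) * s₂ - ξ * X * s₁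

/-- `s₁` and `s₂` are eliminated with the line relations and the recurrence whose roots are `ξ` and
`X`. This leaves `s₃` as a function of the product `ξ X` alone, the sum `ξ + X` being tied to it by
`IsAbscissae.eq`. -/
theorem third_moment (h : OnCurve P Q) (hx : IsAbscissae P Q ξ X)
    (hs : IsAtomMoments P Q ξ X s₀ s₁ s₂ s₃) :
    s₃ * (hgt P Q * ((Q - 2 * P - 2) / 15) - kap P Q * ((Q - 2) / 5) * (ξ * X)) =
      ((Q - 4 * P) / 15) ^ 2 * hgt P Q + ξ * X * (4 / 405 * ((Q - 5 * P) * (Q + P)) * hgt P Q -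
        kap P Q * ((Q - 4 * P) / 15) * ((Q - 2 * P) / 9)) := by
  have r1 := h.row_one
  have r2 := h.row_two
  have e1 := hs.one
  have e2 := hs.two
  have e3 := hs.recur
  have hX := hx.eq
  have hK : 4 / 405 * ((Q - 5 * P) * (Q + P)) =
      (Q - 4 * P) / 15 * (Q / 3) - ((Q - 2 * P) / 9) ^ 2 := by ring
  rw [hK]
  have hf : (Q - 2 * P - 2) / 15 =
    hgt P Q * ((Q - 2 * P) / 9) - kap P Q * ((Q - 4 * P) / 15) := by linarith
  have hd : (Q - 2) / 5 = hgt P Q * (Q / 3) - kap P Q * ((Q - 2 * P) / 9) := by linarith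
  rw [hf, hd]
  generalize hgt P Q = η at *
  generalize kap P Q = κ at *
  generalize (Q - 2 * P) / 9 = b at *
  generalize (Q - 4 * P) / 15 = e at *
  generalize Q / 3 = a at *
  have hsum : b * (ξ + X) = e + a * (ξ * X) := by linear_combination hX
  have step : η * (b * s₃) = (e + a * (ξ * X)) * (e + κ * s₃) - b * (ξ * X) * (b + κ * s₂) := by
    linear_combination η * b * e3 + η * s₂ * hsum + (e + a * (ξ * X)) * e2 - b * (ξ * X) * e1
  linear_combination η * step - b * (ξ * X) * κ * e2

theorem denom_form_pos (h : OnCurve P Q) (hx : IsAbscissae P Q ξ X) :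
    0 < hgt P Q * ((Q - 2 * P - 2) / 15) - kap P Q * ((Q - 2) / 5) * (ξ * X) := by
  have h1 : ξ * X ≤ 0.1 := (h.mul_abscissa_le hx).trans (by nlinarith [h.nonneg, h.le_one])
  have h2 : 0 ≤ ξ * X := mul_nonneg hx.nonneg (h.abscissa_pos hx).le
  have h3 : 0.2 ≤ (Q - 2 * P - 2) / 15 := by linarith [h.seven_le, h.le_one]
  have h4 : (Q - 2) / 5 ≤ 1.1 := by linarith [h.le_box]
  have h5 : kap P Q ≤ 0.44 := by linarith [h.kap_le, h.le_one]
  have h6 := mul_le_mul (mul_le_mul h5 h4 (by linarith [h.seven_le]) (by norm_num)) h1 h2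
    (by norm_num)
  have h7 := mul_le_mul h.hgt_ge h3 (by norm_num) (by linarith [h.hgt_ge])
  linarith

theorem residual_three_upper (h : OnCurve P Q) (hx : IsAbscissae P Q ξ X)
    (hs : IsAtomMoments P Q ξ X s₀ s₁ s₂ s₃) : (Q - 6 * P + 2) / 7 - s₃ ≤ (0.56 - 0.13 * P) := by
  have B := bernstein_nonneg h.nonneg h.le_one
  have hS : 0 ≤ ξ * X := mul_nonneg hx.nonneg (h.abscissa_pos hx).le
  have hc := h.denom_form_pos hx
  have h3 := h.third_moment hx hs
  have hN : 0 ≤ (Q - 6 * P + 2) / 7 - (0.56 - 0.13 * P) := by linarith [h.lower, B 0 4, B 1 3, B 2 2, B 3 1, B 4 0]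
  have hX := mul_le_mul_of_nonneg_left h.excess_upper (by linarith [h.hgt_ge] : 0 ≤ hgt P Q)
  have hB := h.excess_bound
  have hG : 0 ≤ (0.2 - 0.155 * P) := by linarith [h.le_one]
  have hSG : (0.056 - 0.18 * P + 0.1 * P ^ 2) * (0.2 - 0.155 * P) ≤ ξ * X * (4 / 405 * ((Q - 5 * P) * (Q + P)) * hgt P Q -
        kap P Q * ((Q - 4 * P) / 15) * ((Q - 2 * P) / 9)) :=
    (mul_le_mul_of_nonneg_right (h.le_mul_abscissa hx) hG).trans
      (mul_le_mul_of_nonneg_left h.cross_lower hS)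
  have hkd : 0 ≤ kap P Q * ((Q - 2) / 5) * (ξ * X) * ((Q - 6 * P + 2) / 7 - (0.56 - 0.13 * P)) :=
    mul_nonneg (mul_nonneg (mul_nonneg h.kap_nonneg (by linarith [h.seven_le])) hS) hN
  refine le_of_mul_le_mul_right ?_ hc
  linarith

/-- The left side is `η²` times the determinant of the moment matrix of `x, x³, xy²`. At `P = 1`
this matrix mirrors the singular one for `y, x²y, y³`, which explains the factor `1 - P`. -/
theorem discriminant_eq (h : OnCurve P Q) :
    ((Q - 2 * P - 2) / 15) * ((Q - 6 * P + 2) / 7 *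
        (hgt P Q * lineMom1 P Q - kap P Q * lineMom2 P Q) - lineMom2 P Q ^ 2) -
      (hgt P Q * lineMom1 P Q - kap P Q * lineMom2 P Q) * ((Q - 4 * P) / 15) ^ 2 =
    hgt P Q ^ 2 * (48 / 212625 *
      ((1 - P) * (6 * Q ^ 2 + (12 - 12 * P) * Q - 18 - 48 * P - 18 * P ^ 2))) := by
  have hdet : 48 / 212625 *
      ((1 - P) * (6 * Q ^ 2 + (12 - 12 * P) * Q - 18 - 48 * P - 18 * P ^ 2)) =
      (Q - 2 * P + 2) / 3 * ((Q - 6 * P + 2) / 7 * ((Q - 2 * P - 2) / 15) -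
        ((Q - 4 * P) / 15) ^ 2) - (Q - 4 * P + 2) / 5 * ((Q - 4 * P + 2) / 5 *
        ((Q - 2 * P - 2) / 15) - (Q - 4 * P) / 15 * ((Q - 2 * P) / 9)) + (Q - 2 * P) / 9 *
        ((Q - 4 * P + 2) / 5 * ((Q - 4 * P) / 15) - (Q - 6 * P + 2) / 7 * ((Q - 2 * P) / 9)) := by
    linear_combination -(48 / 212625) * h.eq
  have hf : (Q - 2 * P - 2) / 15 =
    hgt P Q * ((Q - 2 * P) / 9) - kap P Q * ((Q - 4 * P) / 15) := by linarith [h.row_two]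
  rw [hdet, hf, lineMom1, lineMom2]
  ring

theorem detFactor_lower (h : OnCurve P Q) :
    360 - 150 * P ≤ 6 * Q ^ 2 + (12 - 12 * P) * Q - 18 - 48 * P - 18 * P ^ 2 := by
  nlinarith only [h.seven_le, mul_nonneg (sub_nonneg.mpr h.le_one) (sub_nonneg.mpr h.seven_le),
    mul_nonneg h.nonneg (sub_nonneg.mpr h.le_one)]

theorem detFactor_upper (h : OnCurve P Q) :
    6 * Q ^ 2 + (12 - 12 * P) * Q - 18 - 48 * P - 18 * P ^ 2 ≤ 410 := by
  have h7 := h.seven_le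
  have hQ2 : Q ^ 2 ≤ 7.48 ^ 2 := pow_le_pow_left₀ (by linarith) h.le_box 2
  have := mul_nonneg h.nonneg (by linarith : 0 ≤ Q)
  nlinarith only [this, hQ2, h.le_box, h.nonneg, sq_nonneg P]

theorem det_dominates_node (hP : 0 ≤ P) (hP1 : P ≤ 1) {f : ℝ} (hf : (5 - 2 * P) / 15 ≤ f) :
    0.1 * (1 - P) * (0.436 * P * 1.1 * (0.028 * (1 - P) + (0.227 - 0.12 * P) * 0.25) +
      (0.227 - 0.12 * P) * (0.212 - 0.14 * P) * f) ≤
      0.0778 * (48 / 212625 * (360 - 150 * P)) * f := by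
  have B := bernstein_nonneg hP hP1
  have hα : 0 ≤ 0.0778 * (48 / 212625 * (360 - 150 * P)) -
      0.1 * (1 - P) * ((0.227 - 0.12 * P) * (0.212 - 0.14 * P)) := by
    linarith only [B 0 4, B 1 3, B 2 2, B 3 1, B 4 0]
  have := mul_le_mul_of_nonneg_left hf hα
  linarith only [this, B 0 5, B 1 4, B 2 3, B 3 2, B 4 1, B 5 0]

/-- After clearing denominators, the difference is a determinant term with a factor `1 - P`, minus
`ξ X` times a bounded correction. Since `ξ X ≤ 0.1 (1 - P)²`, one factor `1 - P` cancels and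
`det_dominates_node` settles the rest. Both terms vanish at `P = 1`. -/
theorem discriminant_lower (h : OnCurve P Q) (hx : IsAbscissae P Q ξ X)
    (hs : IsAtomMoments P Q ξ X s₀ s₁ s₂ s₃) :
    lineMom2 P Q ^ 2 ≤ ((Q - 6 * P + 2) / 7 - s₃) *
      (hgt P Q * lineMom1 P Q - kap P Q * lineMom2 P Q) := by
  have hP := h.nonneg
  have hP1 : 0 ≤ 1 - P := sub_nonneg.mpr h.le_one
  have hc := h.denom_form_pos hx
  have h3 := h.third_moment hx hs
  have hdisc := h.discriminant_eq
  have hW0 := h.tail_form_lower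
  have hW1 := h.tail_form_upper
  have hg0 := h.cross_lower
  have hg1 := h.cross_upper
  have hh0 := h.hgt_ge
  have hh1 := h.hgt_le
  have hk0 := h.kap_nonneg
  have hk1 := h.kap_le
  have hf0 : 0.2 ≤ (Q - 2 * P - 2) / 15 := by linarith [h.seven_le, h.le_one]
  have hd1 : (Q - 2) / 5 ≤ 1.1 := by linarith [h.le_box]
  have he1 : ((Q - 4 * P) / 15) ^ 2 ≤ 0.25 := by
    have : (Q - 4 * P) / 15 ≤ 0.5 := by linarith [h.le_box]
    nlinarith
  have hS1 := h.mul_abscissa_le hx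
  have hL0 := h.detFactor_lower
  have hL1 := h.detFactor_upper
  generalize 6 * Q ^ 2 + (12 - 12 * P) * Q - 18 - 48 * P - 18 * P ^ 2 = L at *
  generalize hgt P Q * lineMom1 P Q - kap P Q * lineMom2 P Q = W at *
  generalize 4 / 405 * ((Q - 5 * P) * (Q + P)) * hgt P Q -
        kap P Q * ((Q - 4 * P) / 15) * ((Q - 2 * P) / 9) = g at *
  generalize lineMom2 P Q = T at *
  have hfl : (5 - 2 * P) / 15 ≤ (Q - 2 * P - 2) / 15 := by linarith [h.seven_le]
  have hd0 : 0 ≤ (Q - 2) / 5 := by linarith [h.seven_le]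
  generalize (Q - 2 * P - 2) / 15 = f at *
  generalize (Q - 2) / 5 = d at *
  generalize (Q - 4 * P) / 15 = e at *
  generalize hgt P Q = η at *
  generalize kap P Q = κ at *
  generalize (Q - 6 * P + 2) / 7 = M at *
  generalize ξ * X = S at *
  have hη2 : η ^ 2 ≤ 0.3 := by nlinarith
  have hη3 : 0.0778 ≤ η ^ 3 := by
    calc (0.0778 : ℝ) ≤ 0.427 ^ 3 := by norm_num
      _ ≤ η ^ 3 := pow_le_pow_left₀ (by norm_num) hh0 3
  have hf : 0 < f := by linarith
  have hL : 0 ≤ L := by linarith [h.le_one]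
  -- the excess caused by the second node product is dominated by the determinant
  have hA : η ^ 2 * (48 / 212625 * ((1 - P) * L)) ≤ 0.028 * (1 - P) := by
    have := mul_le_mul hη2 hL1 hL (by norm_num)
    nlinarith only [mul_le_mul_of_nonneg_left this hP1, hP1]
  have hA0 : 0 ≤ η ^ 2 * (48 / 212625 * ((1 - P) * L)) := by positivity
  have hWe : W * e ^ 2 ≤ (0.227 - 0.12 * P) * 0.25 :=
    mul_le_mul hW1 he1 (sq_nonneg e) (by linarith [h.le_one])
  have hWe0 : 0 ≤ W * e ^ 2 := mul_nonneg (by linarith) (sq_nonneg e)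
  have hkd : κ * d ≤ 0.436 * P * 1.1 := mul_le_mul hk1 hd1 hd0 (by positivity)
  have hWg : W * g ≤ (0.227 - 0.12 * P) * (0.212 - 0.14 * P) :=
    mul_le_mul hW1 hg1 (by linarith [h.le_one]) (by linarith [h.le_one])
  have hbr : κ * d * (η ^ 2 * (48 / 212625 * ((1 - P) * L)) + W * e ^ 2) ≤
      0.436 * P * 1.1 * (0.028 * (1 - P) + (0.227 - 0.12 * P) * 0.25) :=
    mul_le_mul hkd (add_le_add hA hWe) (add_nonneg hA0 hWe0) (by positivity)
  have hbr0 : 0 ≤ κ * d * (η ^ 2 * (48 / 212625 * ((1 - P) * L)) + W * e ^ 2) := by positivity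
  have hWg0 : 0 ≤ W * g := mul_nonneg (by linarith) (by linarith [h.le_one])
  have hdom : S * (κ * d * (η ^ 2 * (48 / 212625 * ((1 - P) * L)) + W * e ^ 2) + W * g * f) ≤
      η ^ 3 * (48 / 212625 * ((1 - P) * L)) * f := by
    have hR := det_dominates_node hP h.le_one hfl
    have h1 : η ^ 3 * (48 / 212625 * L) * f ≥ 0.0778 * (48 / 212625 * (360 - 150 * P)) * f := by
      have : 0 ≤ 360 - 150 * P := by linarith only [h.le_one]
      gcongr
    have h2 : S * (κ * d * (η ^ 2 * (48 / 212625 * ((1 - P) * L)) + W * e ^ 2) + W * g * f) ≤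
        0.1 * (1 - P) ^ 2 * (0.436 * P * 1.1 * (0.028 * (1 - P) + (0.227 - 0.12 * P) * 0.25) +
        (0.227 - 0.12 * P) * (0.212 - 0.14 * P) * f) :=
      mul_le_mul hS1 (add_le_add hbr (mul_le_mul_of_nonneg_right hWg hf.le))
        (add_nonneg hbr0 (mul_nonneg hWg0 hf.le)) (by positivity)
    have h3 := mul_le_mul_of_nonneg_left (hR.trans h1.le) hP1
    linarith only [h2, h3]
  have hfc : 0 < f * (η * f - κ * d * S) := mul_pos hf hc
  refine le_of_mul_le_mul_left ?_ hfc
  have hfinal : f * (η * f - κ * d * S) * ((M - s₃) * W) - f * (η * f - κ * d * S) * T ^ 2 =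
      η ^ 3 * (48 / 212625 * ((1 - P) * L)) * f -
      S * (κ * d * (η ^ 2 * (48 / 212625 * ((1 - P) * L)) + W * e ^ 2) + W * g * f) := by
    linear_combination (η * f - κ * d * S) * hdisc - f * W * h3
  linarith only [hfinal, hdom]

/-- The residual moments after removing the first two node orbits are those of a positive measure
on `[0, 1]`. -/
theorem residual_moments (h : OnCurve P Q) (hx : IsAbscissae P Q ξ X)
    (hs : IsAtomMoments P Q ξ X s₀ s₁ s₂ s₃) {m₀ m₁ m₂ m₃ : ℝ} (hm₀ : m₀ = Q + 2 - s₀)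
    (hm₁ : m₁ = (Q - 2 * P + 2) / 3 - s₁) (hm₂ : m₂ = (Q - 4 * P + 2) / 5 - s₂)
    (hm₃ : m₃ = (Q - 6 * P + 2) / 7 - s₃) :
    0 < m₀ ∧ 0 < m₁ ∧ m₁ ^ 2 < m₀ * m₂ ∧ m₂ ^ 2 ≤ m₁ * m₃ ∧ m₁ < m₀ ∧
      (m₁ - m₂) ^ 2 ≤ (m₀ - m₁) * (m₂ - m₃) := by
  have B := bernstein_nonneg h.nonneg h.le_one
  have hP := h.nonneg
  have hP1 := h.le_one
  have hκ := h.kap_nonneg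
  have hηκ : 0 < hgt P Q - kap P Q := by
    have := h.kap_upper
    have := h.hgt_lower
    linarith [B 0 4, B 1 3, B 2 2, B 3 1, B 4 0]
  -- The line form vanishes on the first two orbits and equals `η - κ X` on the axis, so its moments
  -- involve only the residual. All `mᵢ` are thereby controlled by `m₃`.
  have r0 : hgt P Q * m₀ = lineMom0 P Q + kap P Q * m₁ := by
    rw [hm₀, hm₁, lineMom0]; linear_combination -hs.zero
  have r1 : hgt P Q * m₁ = lineMom1 P Q + kap P Q * m₂ := by
    rw [hm₁, hm₂, lineMom1]; linear_combination -hs.one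
  have r2 : hgt P Q * m₂ = lineMom2 P Q + kap P Q * m₃ := by
    rw [hm₂, hm₃, lineMom2]; linear_combination -hs.two
  have hdisc := h.discriminant_lower hx hs
  have hu := h.residual_three_upper hx hs
  rw [← hm₃] at hdisc hu
  have t1u := h.lineMom1_upper
  have t2 := h.lineMom2_lower
  have d0 := h.lineMom0_sub_lower
  have d1 := h.lineMom1_sub_lower
  have d1u := h.lineMom1_sub_upper
  have hq2 := h.lineMom2_sub_lower
  have hW := h.tail_form_lower
  have hF := h.head_form_lower
  have hE := h.diff_form_lower
  have hhu := h.hgt_upper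
  generalize lineMom0 P Q = T0 at *
  generalize lineMom1 P Q = T1 at *
  generalize lineMom2 P Q = T2 at *
  generalize hgt P Q = η at *
  generalize kap P Q = κ at *
  have hη0 : 0 < η := by linarith
  have hT2 : 0 < T2 := by nlinarith only [t2, hP, hP1]
  have hm3 : 0 < m₃ := by
    refine pos_of_mul_pos_left ((pow_pos hT2 2).trans_le hdisc) (by linarith)
  have hm2 : 0 < m₂ := pos_of_mul_pos_right (r2 ▸ by positivity : 0 < η * m₂) hη0.le
  have hT1 : 0 < T1 := by linarith
  have hm1 : 0 < m₁ := pos_of_mul_pos_right (r1 ▸ by positivity : 0 < η * m₁) hη0.le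
  have hT0 : 0 < T0 := by linarith
  have hm0 : 0 < m₀ := pos_of_mul_pos_right (r0 ▸ by positivity : 0 < η * m₀) hη0.le
  have hη2 : 0 < η ^ 2 := by positivity
  have hd2 : (0.0628 - 0.09 * P + 0.0885 * P ^ 2) ≤ η * (m₂ - m₃) := by
    have := mul_le_mul_of_nonneg_left hu hηκ.le
    linarith only [this, r2, hq2]
  have hQ2 : 0 < (0.0628 - 0.09 * P + 0.0885 * P ^ 2) := by nlinarith only [hP, hP1]
  have hd1' : 0 < η * (m₁ - m₂) := by
    have hpos : 0 < m₂ - m₃ := pos_of_mul_pos_right (hQ2.trans_le hd2) hη0.le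
    have : η * (m₁ - m₂) = (T1 - T2) + κ * (m₂ - m₃) := by linear_combination r1 - r2
    rw [this]
    have := mul_nonneg hκ hpos.le
    linarith only [this, d1, d0, hP]
  have hd0' : 0 < η * (m₀ - m₁) := by
    have hpos : 0 < m₁ - m₂ := pos_of_mul_pos_right hd1' hη0.le
    have : η * (m₀ - m₁) = (T0 - T1) + κ * (m₁ - m₂) := by linear_combination r0 - r1
    rw [this]
    have := mul_nonneg hκ hpos.le
    linarith only [this, d1, d0, hP]
  refine ⟨hm0, hm1, ?_, ?_, ?_, ?_⟩
  · refine lt_of_mul_lt_mul_left ?_ hη2.le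
    -- Each Hankel determinant becomes affine in one residual quantity, so lower bounds on that
    -- quantity and on its coefficient suffice.
    have hV : η ^ 2 * (m₀ * m₂) - η ^ 2 * m₁ ^ 2 = m₂ * (η * T0 - κ * T1) - T1 ^ 2 := by
      linear_combination η * m₂ * r0 + (-(η * m₁) - T1) * r1
    have hηm2 : T2 ≤ η * m₂ := by rw [r2]; linarith only [mul_nonneg hκ hm3.le]
    have h1 : η * T1 ^ 2 < T2 * (η * T0 - κ * T1) := by
      have ha : T2 * 0.62 ≤ T2 * (η * T0 - κ * T1) := mul_le_mul_of_nonneg_left hF hT2.le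
      have hb : η * T1 ^ 2 ≤ (0.42957 + 0.063 * P + 0.0104 * P ^ 2 + 0.0432 * P ^ 3) * (0.515 - 0.22 * P) ^ 2 := by gcongr
      linarith only [ha, hb, mul_le_mul_of_nonneg_right t2 (by norm_num : (0 : ℝ) ≤ 0.62), B 0 5, B 1 4, B 2 3, B 3 2, B 4 1, B 5 0]
    have h2 : T2 * (η * T0 - κ * T1) ≤ η * m₂ * (η * T0 - κ * T1) :=
      mul_le_mul_of_nonneg_right hηm2 (by linarith)
    have h3 : T1 ^ 2 < m₂ * (η * T0 - κ * T1) := by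
      refine lt_of_mul_lt_mul_left ?_ hη0.le
      linarith only [h1, h2]
    linarith only [hV, h3]
  · refine le_of_mul_le_mul_left ?_ hη2
    have hz : η ^ 2 * (m₁ * m₃) - η ^ 2 * m₂ ^ 2 = m₃ * (η * T1 - κ * T2) - T2 ^ 2 := by
      linear_combination η * m₃ * r1 + (-(η * m₂) - T2) * r2
    linarith only [hz, hdisc]
  · have := pos_of_mul_pos_right hd0' hη0.le
    linarith only [this]
  · refine le_of_mul_le_mul_left ?_ hη2
    have hZ : η ^ 2 * ((m₀ - m₁) * (m₂ - m₃)) - η ^ 2 * (m₁ - m₂) ^ 2 =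
        (m₂ - m₃) * (η * (T0 - T1) - κ * (T1 - T2)) - (T1 - T2) ^ 2 := by
      linear_combination η * (m₂ - m₃) * (r0 - r1) + (-(η * (m₁ - m₂)) - (T1 - T2)) * (r1 - r2)
    have h1 : η * (T1 - T2) ^ 2 ≤ (0.0628 - 0.09 * P + 0.0885 * P ^ 2) * (0.43 + 0.1 * P) := by
      have : η * (T1 - T2) ^ 2 ≤ (0.42957 + 0.063 * P + 0.0104 * P ^ 2 + 0.0432 * P ^ 3) * (0.207 - 0.02 * P) ^ 2 := by gcongr
      linarith only [this, B 0 13, B 1 12, B 2 11, B 3 10, B 4 9, B 5 8, B 6 7, B 7 6, B 8 5, B 9 4, B 10 3, B 11 2, B 12 1, B 13 0]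
    have h2 : (0.0628 - 0.09 * P + 0.0885 * P ^ 2) * (0.43 + 0.1 * P) ≤
        η * (m₂ - m₃) * (η * (T0 - T1) - κ * (T1 - T2)) :=
      mul_le_mul hd2 hE (by positivity) (hQ2.le.trans hd2)
    have h3 : (T1 - T2) ^ 2 ≤ (m₂ - m₃) * (η * (T0 - T1) - κ * (T1 - T2)) := by
      refine le_of_mul_le_mul_left ?_ hη0
      linarith only [h1, h2]
    linarith only [hZ, h3]

end OnCurve

end OCAD

/-! ### The two-point Gauss rule. -/

namespace OCAD

theorem rpow_three_halves {a : ℝ} (ha : 0 ≤ a) : a ^ (3 / 2 : ℝ) = √a ^ 3 := by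
  rw [Real.sqrt_eq_rpow, ← Real.rpow_natCast, ← Real.rpow_mul ha]
  norm_num

/-- The two-point Gauss quadrature of a positive measure on `[0, 1]` in the variable `z²`. -/
theorem twoPoint_gauss {m : ℕ → ℝ} (h0 : 0 < m 0) (h2 : 0 < m 2)
    (hv : m 2 ^ 2 < m 0 * m 4) (hz : m 4 ^ 2 ≤ m 2 * m 6) (h20 : m 2 < m 0)
    (hz' : (m 2 - m 4) ^ 2 ≤ (m 0 - m 2) * (m 4 - m 6)) :
    0 < weight3 m ∧ 0 < weight4 m ∧ coord3 m ∈ Set.Icc (0 : ℝ) 1 ∧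
    coord4 m ∈ Set.Icc (0 : ℝ) 1 ∧ coord3 m ≠ coord4 m ∧
    weight3 m + weight4 m = m 0 ∧
    weight3 m * coord3 m ^ 2 + weight4 m * coord4 m ^ 2 = m 2 ∧
    weight3 m * coord3 m ^ 4 + weight4 m * coord4 m ^ 4 = m 4 ∧
    weight3 m * coord3 m ^ 6 + weight4 m * coord4 m ^ 6 = m 6 := by
  have hv0 : 0 < m 4 * m 0 - m 2 ^ 2 := by linarith
  set s := √(m 4 * m 0 - m 2 ^ 2) with hs
  have hs2 : s ^ 2 = m 4 * m 0 - m 2 ^ 2 := Real.sq_sqrt hv0.le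
  have hrpow : (m 4 * m 0 - m 2 ^ 2) ^ (3 / 2 : ℝ) = s ^ 3 := rpow_three_halves hv0.le
  set g := beta4 m with hg
  have hgs : g * s ^ 3 = m 6 * m 0 ^ 2 - 3 * m 4 * m 2 * m 0 + 2 * m 2 ^ 3 := by
    rw [hg, beta4, hrpow, div_mul_cancel₀ _ (by positivity)]
  set ρ := √(g ^ 2 + 4) with hρ
  have hρ0 : 0 < ρ := Real.sqrt_pos.mpr (by positivity)
  have hρ2 : ρ ^ 2 = g ^ 2 + 4 := Real.sq_sqrt (by positivity)
  have hgρ : |g| < ρ := abs_lt_of_sq_lt_sq (by rw [hρ2]; linarith) hρ0.le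
  obtain ⟨hg1, hg2⟩ := abs_lt.mp hgρ
  -- A two-point law of mean 0, variance 1 and skewness `g` has its atoms at `-k` and `l`, where `k
  -- l = 1` and `l - k = g`. The nodes in `z²` are its image under `u ↦ μ + σ u`.
  set k := (ρ - g) / 2 with hk
  set l := (ρ + g) / 2 with hl
  have hk0 : 0 < k := by rw [hk]; linarith
  have hl0 : 0 < l := by rw [hl]; linarith
  have hkl : k * l = 1 := by rw [hk, hl]; linear_combination hρ2 / 4
  have hlk : l - k = g := by rw [hk, hl]; ring
  have hlkρ : l + k = ρ := by rw [hk, hl]; ring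
  have hw3 : weight3 m = m 0 * l / (l + k) := by
    rw [weight3, ← hg, ← hρ, ← hlkρ, ← hlk]
    field_simp
    ring
  have hw4 : weight4 m = m 0 * k / (l + k) := by
    rw [weight4, ← hg, ← hρ, ← hlkρ, ← hlk]
    field_simp
    ring
  have hw30 : 0 < weight3 m := by rw [hw3]; positivity
  have hw40 : 0 < weight4 m := by rw [hw4]; positivity
  have hk' : k = 1 / l := by field_simp; linarith
  have hr43 : √(weight4 m / weight3 m) = k := by
    rw [Real.sqrt_eq_iff_mul_self_eq (by positivity) hk0.le, hw3, hw4, hk']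
    field_simp
  have hr34 : √(weight3 m / weight4 m) = l := by
    rw [Real.sqrt_eq_iff_mul_self_eq (by positivity) hl0.le, hw3, hw4, hk']
    field_simp
  set σ := s / m 0 with hσ
  have hσ0 : 0 < σ := by positivity
  set Z3 := m 2 / m 0 - k * σ with hZ3
  set Z4 := m 2 / m 0 + l * σ with hZ4
  have hsum : weight3 m + weight4 m = m 0 := by
    rw [hw3, hw4]; field_simp
  have hbal : weight4 m * l = weight3 m * k := by
    rw [hw3, hw4]; ring
  have hm2 : m 2 = m 0 * (m 2 / m 0) := by field_simp
  have hm0σ : m 0 * σ = s := by rw [hσ]; field_simp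
  generalize hμ : m 2 / m 0 = μ at *
  have e1 : weight3 m * Z3 + weight4 m * Z4 = m 2 := by
    rw [hZ3, hZ4, hm2]
    linear_combination μ * hsum + σ * hbal
  have hm4 : m 4 = m 0 * (μ ^ 2 + σ ^ 2) := by
    refine mul_left_cancel₀ h0.ne' ?_
    have : m 0 ^ 2 * σ ^ 2 = m 4 * m 0 - m 2 ^ 2 := by rw [← hs2, ← hm0σ]; ring
    linear_combination (-1) * this + (m 2 + m 0 * μ) * hm2
  have hkk : weight3 m * k ^ 2 = weight4 m := by
    linear_combination (-k) * hbal + weight4 m * hkl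
  have hll : weight4 m * l ^ 2 = weight3 m := by
    linear_combination l * hbal + weight3 m * hkl
  have e2 : weight3 m * Z3 ^ 2 + weight4 m * Z4 ^ 2 = m 4 := by
    rw [hZ3, hZ4, hm4]
    linear_combination (μ ^ 2 + σ ^ 2) * hsum + 2 * μ * σ * hbal + σ ^ 2 * hkk + σ ^ 2 * hll
  have hm6 : m 6 = m 0 * (μ ^ 3 + 3 * μ * σ ^ 2 + g * σ ^ 3) := by
    refine mul_left_cancel₀ (pow_pos h0 2).ne' ?_
    have h3 : m 0 ^ 3 * (g * σ ^ 3) = g * s ^ 3 := by rw [← hm0σ]; ring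
    rw [hgs] at h3
    rw [hm4, hm2] at h3
    linear_combination (-1) * h3
  have e3 : weight3 m * Z3 ^ 3 + weight4 m * Z4 ^ 3 = m 6 := by
    rw [hZ3, hZ4, hm6, ← hlk]
    have h33 : weight4 m * l ^ 3 - weight3 m * k ^ 3 = m 0 * (l - k) := by
      linear_combination l * hll - k * hkk + (l - k) * hsum - hbal
    linear_combination (μ ^ 3 + 3 * μ * σ ^ 2) * hsum + 3 * μ ^ 2 * σ * hbal +
      3 * μ * σ ^ 2 * hkk + 3 * μ * σ ^ 2 * hll + σ ^ 3 * h33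
  have hμ0 : 0 < μ := by rw [← hμ]; positivity
  have hμ1 : μ < 1 := by rw [← hμ, div_lt_one h0]; exact h20
  have hlt : Z3 < Z4 := by
    rw [hZ3, hZ4]; linarith [mul_pos hk0 hσ0, mul_pos hl0 hσ0]
  have hZ4pos : 0 < Z4 := by rw [hZ4]; positivity
  have hZ3lt : Z3 < 1 := by rw [hZ3]; linarith [mul_pos hk0 hσ0]
  have hww : 0 < weight3 m * weight4 m * (Z4 - Z3) ^ 2 :=
    mul_pos (mul_pos hw30 hw40) (pow_pos (sub_pos.mpr hlt) 2)
  -- The Hankel determinants of a two-atom measure factor through its atoms, so the two remaining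
  -- hypotheses give `0 ≤ Z3` and `Z4 ≤ 1`.
  have hZ3nn : 0 ≤ Z3 := by
    have h1 : m 2 * m 6 - m 4 ^ 2 = weight3 m * weight4 m * (Z4 - Z3) ^ 2 * Z4 * Z3 := by
      rw [← e1, ← e2, ← e3]; ring
    exact nonneg_of_mul_nonneg_right (by rw [← h1]; linarith) (mul_pos hww hZ4pos)
  have hZ4le : Z4 ≤ 1 := by
    have h1 : (m 0 - m 2) * (m 4 - m 6) - (m 2 - m 4) ^ 2 =
        weight3 m * weight4 m * (Z4 - Z3) ^ 2 * (1 - Z3) * (1 - Z4) := by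
      rw [← hsum, ← e1, ← e2, ← e3]; ring
    have h2 : 0 ≤ 1 - Z4 := nonneg_of_mul_nonneg_right (by rw [← h1]; linarith)
      (mul_pos hww (sub_pos.mpr hZ3lt))
    linarith
  have hc3 : coord3 m = √Z3 := by rw [coord3, hr43, hμ, hZ3]
  have hc4 : coord4 m = √Z4 := by rw [coord4, hr34, hμ, hZ4]
  have hc3sq : coord3 m ^ 2 = Z3 := by rw [hc3, Real.sq_sqrt hZ3nn]
  have hc4sq : coord4 m ^ 2 = Z4 := by rw [hc4, Real.sq_sqrt hZ4pos.le]
  refine ⟨hw30, hw40, ?_, ?_, ?_, hsum, ?_, ?_, ?_⟩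
  · rw [hc3]; exact ⟨Real.sqrt_nonneg _, Real.sqrt_le_one.mpr hZ3lt.le⟩
  · rw [hc4]; exact ⟨Real.sqrt_nonneg _, Real.sqrt_le_one.mpr hZ4le⟩
  · intro h
    rw [← hc3sq, ← hc4sq, h] at hlt
    exact lt_irrefl _ hlt
  · rw [hc3sq, hc4sq, e1]
  · rw [show coord3 m ^ 4 = (coord3 m ^ 2) ^ 2 by ring, show coord4 m ^ 4 = (coord4 m ^ 2) ^ 2 by ring,
      hc3sq, hc4sq, e2]
  · rw [show coord3 m ^ 6 = (coord3 m ^ 2) ^ 3 by ring, show coord4 m ^ 6 = (coord4 m ^ 2) ^ 3 by ring,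
      hc3sq, hc4sq, e3]

end OCAD

/-! ### Location of the first abscissa. -/

namespace OCAD
namespace OnCurve

variable {P Q : ℝ}

/-- With `c ≈ (√30 + 2) / 36`, the abscissa of the first node orbit is at least
`0.105 ((1 - P) / (1 + P))²`. -/
theorem abscissa_form_lower (h : OnCurve P Q) {c : ℝ} (hc : 0.2076 ≤ c) (hc' : c ≤ 0.2079) :
    0 ≤ c * ((Q - 4 * P) / 15) ^ 2 * (Q / 3) * (1 + P) ^ 4 -
      0.105 * (2 * ((Q - 2 * P) / 9) * (1 + P) ^ 2 - Q / 3 * 0.105 * (1 - P) ^ 2) *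
      (4 / 405 * ((Q - 5 * P) * (Q + P)) * (1 + P) ^ 2 +
        c * ((Q - 4 * P) / 15) * (Q / 3) * (1 - P) ^ 2) := by
  -- Tensor Bernstein basis on the box `0 ≤ P ≤ 1`, `7 ≤ Q ≤ 7.48`; the curve equation is not needed
  -- here.
  have B : ∀ i j k l : ℕ, 0 ≤ P ^ i * (1 - P) ^ j * ((Q - 7) ^ k * (7.48 - Q) ^ l) :=
    fun i j k l => mul_nonneg (bernstein_nonneg h.nonneg h.le_one i j)
      (mul_nonneg (pow_nonneg (sub_nonneg.mpr h.seven_le) k)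
        (pow_nonneg (sub_nonneg.mpr h.le_box) l))
  have := affine_nonneg (α := -(0.105 * (2 * ((Q - 2 * P) / 9) * (1 + P) ^ 2 -
      Q / 3 * 0.105 * (1 - P) ^ 2) * (4 / 405 * ((Q - 5 * P) * (Q + P)) * (1 + P) ^ 2)))
    (β := ((Q - 4 * P) / 15) ^ 2 * (Q / 3) * (1 + P) ^ 4 -
      0.105 * (2 * ((Q - 2 * P) / 9) * (1 + P) ^ 2 - Q / 3 * 0.105 * (1 - P) ^ 2) *
      (((Q - 4 * P) / 15) * (Q / 3) * (1 - P) ^ 2)) hc hc' ?_ ?_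
  · linarith
  all_goals linarith only [B 0 7 0 3, B 0 7 1 2, B 0 7 2 1, B 0 7 3 0, B 1 6 0 3, B 1 6 1 2, B 1 6 2 1, B 1 6 3 0, B 2 5 0 3, B 2 5 1 2, B 2 5 2 1, B 2 5 3 0, B 3 4 0 3, B 3 4 1 2, B 3 4 2 1, B 3 4 3 0, B 4 3 0 3, B 4 3 1 2, B 4 3 2 1, B 4 3 3 0, B 5 2 0 3, B 5 2 1 2, B 5 2 2 1, B 5 2 3 0, B 6 1 0 3, B 6 1 1 2, B 6 1 2 1, B 6 1 3 0, B 7 0 0 3, B 7 0 1 2, B 7 0 2 1, B 7 0 3 0]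

theorem abscissa_form_upper (h : OnCurve P Q) {c : ℝ} (hc : 0.2076 ≤ c) (hc' : c ≤ 0.2079) :
    c * ((Q - 4 * P) / 15) ^ 2 * (Q / 3) * (1 + P) ^ 4 ≤
      0.125 * (2 * ((Q - 2 * P) / 9) * (1 + P) ^ 2 - Q / 3 * 0.125 * (1 - P) ^ 2) *
      (4 / 405 * ((Q - 5 * P) * (Q + P)) * (1 + P) ^ 2 +
        c * ((Q - 4 * P) / 15) * (Q / 3) * (1 - P) ^ 2) := by
  have B : ∀ i j k l : ℕ, 0 ≤ P ^ i * (1 - P) ^ j * ((Q - 7) ^ k * (7.48 - Q) ^ l) :=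
    fun i j k l => mul_nonneg (bernstein_nonneg h.nonneg h.le_one i j)
      (mul_nonneg (pow_nonneg (sub_nonneg.mpr h.seven_le) k)
        (pow_nonneg (sub_nonneg.mpr h.le_box) l))
  have := affine_nonneg (α := 0.125 * (2 * ((Q - 2 * P) / 9) * (1 + P) ^ 2 -
      Q / 3 * 0.125 * (1 - P) ^ 2) * (4 / 405 * ((Q - 5 * P) * (Q + P)) * (1 + P) ^ 2))
    (β := 0.125 * (2 * ((Q - 2 * P) / 9) * (1 + P) ^ 2 - Q / 3 * 0.125 * (1 - P) ^ 2) *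
      (((Q - 4 * P) / 15) * (Q / 3) * (1 - P) ^ 2) -
      ((Q - 4 * P) / 15) ^ 2 * (Q / 3) * (1 + P) ^ 4) hc hc' ?_ ?_
  · linarith
  all_goals linarith only [B 0 7 0 3, B 0 7 1 2, B 0 7 2 1, B 0 7 3 0, B 1 6 0 3, B 1 6 1 2, B 1 6 2 1, B 1 6 3 0, B 2 5 0 3, B 2 5 1 2, B 2 5 2 1, B 2 5 3 0, B 3 4 0 3, B 3 4 1 2, B 3 4 2 1, B 3 4 3 0, B 4 3 0 3, B 4 3 1 2, B 4 3 2 1, B 4 3 3 0, B 5 2 0 3, B 5 2 1 2, B 5 2 2 1, B 5 2 3 0, B 6 1 0 3, B 6 1 1 2, B 6 1 2 1, B 6 1 3 0, B 7 0 0 3, B 7 0 1 2, B 7 0 2 1, B 7 0 3 0]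

end OnCurve
end OCAD

namespace OCAD

/-- `√30 + 2` is the value of `Q` at `θ = 0`. Only this enclosure of the constant in `β₁` enters the
estimates. -/
theorem sqrt_thirty_bounds : 0.2076 ≤ (√30 + 2) / 36 ∧ (√30 + 2) / 36 ≤ 0.2079 := by
  have h1 : (5.4736 : ℝ) ≤ √30 := Real.le_sqrt_of_sq_le (by norm_num)
  have h2 : √30 ≤ (5.4844 : ℝ) := Real.sqrt_le_iff.mpr ⟨by norm_num, by norm_num⟩
  constructor <;> linarith

/-- The lower abscissa `(b - τ) / a` of the two-point rule with moments `a, b, e` and relative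
weights `β, 1 - β`, where `1 - β = (b² - η) / (e a)`, is compared with `ζ`. -/
theorem le_lower_abscissa {a b e η τ ζ : ℝ} (hδ : 0 < e * a - b ^ 2) (hη : 0 ≤ η)
    (hτ : (e * a - b ^ 2 + η) * τ ^ 2 = (e * a - b ^ 2) * (b ^ 2 - η)) (hζ : a * ζ ≤ b)
    (hle : a * ζ * (2 * b - a * ζ) * (e * a - b ^ 2 + η) ≤ η * (e * a)) : a * ζ ≤ b - τ := by
  have : τ ^ 2 ≤ (b - a * ζ) ^ 2 := by
    refine le_of_mul_le_mul_left ?_ (by linarith : 0 < e * a - b ^ 2 + η)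
    rw [hτ]; linarith
  linarith [le_of_sq_le_sq this (sub_nonneg.mpr hζ)]

theorem lower_abscissa_le {a b e η τ ζ : ℝ} (hδ : 0 < e * a - b ^ 2) (hη : 0 ≤ η) (hτ0 : 0 ≤ τ)
    (hτ : (e * a - b ^ 2 + η) * τ ^ 2 = (e * a - b ^ 2) * (b ^ 2 - η))
    (hle : η * (e * a) ≤ a * ζ * (2 * b - a * ζ) * (e * a - b ^ 2 + η)) : b - τ ≤ a * ζ := by
  have : (b - a * ζ) ^ 2 ≤ τ ^ 2 := by
    refine le_of_mul_le_mul_left ?_ (by linarith : 0 < e * a - b ^ 2 + η)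
    rw [hτ]; linarith
  linarith [le_of_sq_le_sq this hτ0]

namespace OnCurve

variable {P Q : ℝ}

theorem weight_bounds (h : OnCurve P Q) {c r β : ℝ} (hc : 0.2076 ≤ c) (hc' : c ≤ 0.2079)
    (hr : r * (1 + P) ^ 2 = (1 - P) ^ 2)
    (hβ : β = 1 - ((Q - 2 * P) / 9) ^ 2 / ((Q - 4 * P) / 15 * (Q / 3)) + c * r) :
    0 < β ∧ β < 1 := by
  have hea : 0 < (Q - 4 * P) / 15 * (Q / 3) :=
    mul_pos (by linarith [h.seven_le, h.le_one]) (by linarith [h.seven_le])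
  have hP := h.nonneg
  have hr0 : 0 ≤ r := nonneg_of_mul_nonneg_left (by rw [hr]; positivity) (by positivity)
  have hr1 : r ≤ 1 := by
    refine le_of_mul_le_mul_right ?_ (by positivity : 0 < (1 + P) ^ 2)
    rw [hr]; nlinarith
  have hcr : c * r ≤ 0.2079 := by nlinarith
  have hcr0 : 0 ≤ c * r := by nlinarith
  have h1 : ((Q - 2 * P) / 9) ^ 2 / ((Q - 4 * P) / 15 * (Q / 3)) < 1 := by
    rw [div_lt_one hea]; linarith [h.prod_pos]
  have h2 : 0.5 ≤ ((Q - 2 * P) / 9) ^ 2 / ((Q - 4 * P) / 15 * (Q / 3)) := by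
    rw [le_div_iff₀ hea]; nlinarith
  constructor <;> linarith

/-- Without the term `c * r` in `β`, the lower abscissa would be exactly zero. The term moves it to
between `0.105 r` and `0.125 r`, where `r = θ²`, by the two abscissa forms. -/
theorem isAbscissae (h : OnCurve P Q) {c r β τ : ℝ} (hc : 0.2076 ≤ c) (hc' : c ≤ 0.2079)
    (hr : r * (1 + P) ^ 2 = (1 - P) ^ 2)
    (hβ : β = 1 - ((Q - 2 * P) / 9) ^ 2 / ((Q - 4 * P) / 15 * (Q / 3)) + c * r) (hτ : 0 < τ)
    (hτβ : β * τ ^ 2 = (1 - β) * (4 / 405 * ((Q - 5 * P) * (Q + P)))) :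
    IsAbscissae P Q (((Q - 2 * P) / 9 - τ) / (Q / 3))
      (((Q - 2 * P) / 9 + 4 / 405 * ((Q - 5 * P) * (Q + P)) / τ) / (Q / 3)) := by
  have hP := h.nonneg
  have hP1 := h.le_one
  have h7 := h.seven_le
  have ha : 0 < Q / 3 := by linarith
  have he : 0 < (Q - 4 * P) / 15 := by linarith
  have hea : 0 < (Q - 4 * P) / 15 * (Q / 3) := mul_pos he ha
  have hr0 : 0 ≤ r := nonneg_of_mul_nonneg_left (by rw [hr]; positivity) (by positivity)
  have hδ : 4 / 405 * ((Q - 5 * P) * (Q + P)) =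
      (Q - 4 * P) / 15 * (Q / 3) - ((Q - 2 * P) / 9) ^ 2 := by ring
  have hlow := h.abscissa_form_lower hc hc'
  have hup := h.abscissa_form_upper hc hc'
  have hδ0 : 0 < 4 / 405 * ((Q - 5 * P) * (Q + P)) := by linarith [h.prod_pos]
  rw [hδ] at hlow hup hδ0 hτβ ⊢
  generalize hb : (Q - 2 * P) / 9 = b at *
  generalize he' : (Q - 4 * P) / 15 = e at *
  generalize ha' : Q / 3 = a at *
  have hP2 : 0 < (1 + P) ^ 2 := by positivity
  have hη : 0 ≤ c * r * (e * a) := mul_nonneg (mul_nonneg (by linarith) hr0) hea.le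
  have hτ2 : (e * a - b ^ 2 + c * r * (e * a)) * τ ^ 2 =
      (e * a - b ^ 2) * (b ^ 2 - c * r * (e * a)) := by
    have hβ' : β * (e * a) = e * a - b ^ 2 + c * r * (e * a) := by
      rw [hβ]; field_simp
    linear_combination (-τ ^ 2 - (e * a - b ^ 2)) * hβ' + e * a * hτβ
  -- Multiplying by `(1 + P)⁴` removes `r` through `r (1 + P)² = (1 - P)²`.
  have hscale : ∀ {u v : ℝ}, 0 ≤ ((1 + P) ^ 2) ^ 2 * (v - u) → u ≤ v := fun h =>
    sub_nonneg.mp (nonneg_of_mul_nonneg_right h (by positivity))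
  have h1 : a * (0.105 * r) ≤ b - τ := by
    refine le_lower_abscissa hδ0 hη hτ2 (by nlinarith) (hscale ?_)
    have := mul_nonneg (mul_nonneg ha.le hr0) hlow
    have e1 : ((1 + P) ^ 2) ^ 2 * (c * r * (e * a) * (e * a) - a * (0.105 * r) *
        (2 * b - a * (0.105 * r)) * (e * a - b ^ 2 + c * r * (e * a))) =
        a * r * (c * e ^ 2 * a * (1 + P) ^ 4 - 0.105 * (2 * b * (1 + P) ^ 2 - a * 0.105 *
          (r * (1 + P) ^ 2)) * ((e * a - b ^ 2) * (1 + P) ^ 2 + c * e * a *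
          (r * (1 + P) ^ 2))) := by ring
    rw [e1, hr]
    exact this
  have h2 : b - τ ≤ a * (0.125 * r) := by
    refine lower_abscissa_le hδ0 hη hτ.le hτ2 (hscale ?_)
    have := mul_nonneg (mul_nonneg ha.le hr0) (sub_nonneg.mpr hup)
    have e1 : ((1 + P) ^ 2) ^ 2 * (a * (0.125 * r) *
        (2 * b - a * (0.125 * r)) * (e * a - b ^ 2 + c * r * (e * a)) -
        c * r * (e * a) * (e * a)) =
        a * r * (0.125 * (2 * b * (1 + P) ^ 2 - a * 0.125 *
          (r * (1 + P) ^ 2)) * ((e * a - b ^ 2) * (1 + P) ^ 2 + c * e * a *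
          (r * (1 + P) ^ 2)) - c * e ^ 2 * a * (1 + P) ^ 4) := by ring
    rw [e1, hr]
    exact this
  have h3 : 0.105 * r ≤ (b - τ) / a := by rw [le_div_iff₀ ha]; linarith
  have h4 : (b - τ) / a ≤ 0.125 * r := by rw [div_le_iff₀ ha]; linarith
  refine ⟨by linarith, ?_, ?_, ?_⟩
  · rw [← hr, ← mul_assoc]; exact mul_le_mul_of_nonneg_right h3 hP2.le
  · rw [← hr, ← mul_assoc]; exact mul_le_mul_of_nonneg_right h4 hP2.le
  · rw [hb, ha', he']
    field_simp
    ring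

end OnCurve
end OCAD

/-! ### From the explicit formulas to atoms on the line. -/

namespace OCAD

/-- The moments in the coordinates `P = (1 + θ) / (1 - θ)` and `Q`, up to a common factor. -/
structure ScaledMoments (θ P Q l : ℝ) : Prop where
  onCurve : OnCurve P Q
  pos : 0 < l
  sq : θ ^ 2 * (1 + P) ^ 2 = (1 - P) ^ 2
  mom_eq : ∀ i j : ℕ, mom θ i j = l * ((Q + 2 - P * i - j) / ((1 + i) * (1 + j)))

theorem wStar_pos {θ : ℝ} (hθ : |θ| ≤ 1) : 0 < wStar θ := by
  rw [wStar_eq]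
  have := seven_le_trigRoot (abs_nonneg θ) hθ
  have := abs_nonneg θ
  exact inv_pos.mpr (by linarith)

theorem exists_scaledMoments {θ : ℝ} (hθ : -1 ≤ θ) (hθ0 : θ ≤ 0) :
    ∃ P Q l, ScaledMoments θ P Q l := by
  obtain ⟨t, rfl⟩ : ∃ t, θ = -t := ⟨-θ, by ring⟩
  have h0 : 0 ≤ t := by linarith
  have h1 : t ≤ 1 := by linarith
  have habs : |(-t)| = t := by rw [abs_neg, abs_of_nonneg h0]
  have hw := wStar_pos (habs.trans_le h1)
  have hweq := wStar_eq (-t)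
  have h7 := seven_le_trigRoot h0 h1
  have hroot := (trigRoot_spec h0 h1).1
  rw [habs] at hweq
  generalize trigRoot t = R at *
  have ht : 0 < 1 + t := by linarith
  refine ⟨(1 - t) / (1 + t), R / (1 + t), wStar (-t) * (1 + t), ⟨by positivity, ?_, ?_, ?_⟩,
    by positivity, ?_, ?_⟩
  · rw [div_le_one ht]; linarith
  · rw [le_div_iff₀ ht]; linarith
  · have e1 : R / (1 + t) - 4 * ((1 - t) / (1 + t)) = (R - 4 * (1 - t)) / (1 + t) := by ring
    have e2 : R / (1 + t) - 7 = (R - 7 * (1 + t)) / (1 + t) := by field_simp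
    have e3 : R / (1 + t) + 3 = (R + 3 * (1 + t)) / (1 + t) := by field_simp
    have e4 : R / (1 + t) - 4 = (R - 4 * (1 + t)) / (1 + t) := by field_simp
    rw [e1, e2, e3, e4, div_mul_div_comm, div_mul_div_comm, hroot, div_pow]
    field_simp
  · field_simp
    ring
  · intro i j
    have hR : 0 < R + 4 + 2 * t := by linarith
    rw [mom, hweq]
    field_simp
    ring

theorem sqrt_smul_sq {l x : ℝ} (hl : 0 ≤ l) : √(l ^ 2 * x) = l * √x := by
  rw [Real.sqrt_mul (sq_nonneg l), Real.sqrt_sq hl]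

/-- The square roots in the formulas for a two-point rule with relative weights `β, 1 - β`. -/
theorem exists_deviation {β δ : ℝ} (h0 : 0 < β) (h1 : β < 1) (hδ : 0 < δ) :
    ∃ τ, 0 < τ ∧ β * τ ^ 2 = (1 - β) * δ ∧ (∀ l, 0 ≤ l → √((1 - β) * (l ^ 2 * δ) / β) = l * τ) ∧
      ∀ l, 0 ≤ l → √(β * (l ^ 2 * δ) / (1 - β)) = l * (δ / τ) := by
  have hpos : 0 < (1 - β) * δ / β := by positivity
  have hτ := Real.sqrt_pos.mpr hpos
  have hsq := Real.sq_sqrt hpos.le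
  refine ⟨√((1 - β) * δ / β), hτ, by rw [hsq]; field_simp, fun l hl => ?_, fun l hl => ?_⟩
  · rw [← sqrt_smul_sq hl]; congr 1; ring
  · rw [show β * (l ^ 2 * δ) / (1 - β) = l ^ 2 * (β * δ / (1 - β)) by ring, sqrt_smul_sq hl]
    congr 1
    rw [Real.sqrt_eq_iff_mul_self_eq (by positivity) (by positivity)]
    generalize √((1 - β) * δ / β) = τ at *
    rw [div_mul_div_comm, ← sq τ, hsq]
    field_simp

namespace Neg

variable {θ P Q l : ℝ}

/-- The first two node orbits reproduce the moments `⟨y²⟩, ⟨x²y²⟩, ⟨x⁴y²⟩`. -/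
structure Atoms (θ P Q l : ℝ) : Prop where
  abscissae : OnCurve.IsAbscissae P Q (x1 θ ^ 2) (x2 θ ^ 2)
  lt : x1 θ ^ 2 < x2 θ ^ 2
  ordinate_one : y1 θ ^ 2 = hgt P Q - kap P Q * x1 θ ^ 2
  ordinate_two : y2 θ ^ 2 = hgt P Q - kap P Q * x2 θ ^ 2
  weight_one : 0 < weight1 θ
  weight_two : 0 < weight2 θ
  zero : weight1 θ * y1 θ ^ 2 + weight2 θ * y2 θ ^ 2 = l * (Q / 3)
  one : weight1 θ * y1 θ ^ 2 * x1 θ ^ 2 + weight2 θ * y2 θ ^ 2 * x2 θ ^ 2 =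
    l * ((Q - 2 * P) / 9)
  two : weight1 θ * y1 θ ^ 2 * x1 θ ^ 4 + weight2 θ * y2 θ ^ 2 * x2 θ ^ 4 =
    l * ((Q - 4 * P) / 15)

theorem _root_.OCAD.ScaledMoments.atoms (h : ScaledMoments θ P Q l) : Atoms θ P Q l := by
  obtain ⟨hc, hl, hsq, hm⟩ := h
  have h02 : mom θ 0 2 = l * (Q / 3) := by rw [hm]; push_cast; ring
  have h22 : mom θ 2 2 = l * ((Q - 2 * P) / 9) := by rw [hm]; push_cast; ring
  have h42 : mom θ 4 2 = l * ((Q - 4 * P) / 15) := by rw [hm]; push_cast; ring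
  have h04 : mom θ 0 4 = l * ((Q - 2) / 5) := by rw [hm]; push_cast; ring
  have h06 : mom θ 0 6 = l * ((Q - 4) / 7) := by rw [hm]; push_cast; ring
  have h7 := hc.seven_le
  have ha : 0 < Q / 3 := by linarith
  have hδ : 4 / 405 * ((Q - 5 * P) * (Q + P)) =
      (Q - 4 * P) / 15 * (Q / 3) - ((Q - 2 * P) / 9) ^ 2 := by ring
  have hδ0 : 0 < 4 / 405 * ((Q - 5 * P) * (Q + P)) := by linarith [hc.prod_pos]
  have hβ1 : beta1 θ = 1 - ((Q - 2 * P) / 9) ^ 2 / ((Q - 4 * P) / 15 * (Q / 3)) +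
      (√30 + 2) / 36 * θ ^ 2 := by
    rw [beta1, h22, h42, h02]
    congr 2
    field_simp
  have hβ2 : beta2 θ = l ^ 2 * (4 / 405 * ((Q - 5 * P) * (Q + P))) := by
    rw [beta2, h22, h42, h02]; ring
  -- On the line `Y = η - κ X` the variance of `Y` is `κ²` times that of `X`. The square roots for
  -- the ordinates are therefore `κ` times those for the abscissae, with opposite signs in front.
  have hβ3 : beta3 θ = (l * kap P Q) ^ 2 * (4 / 405 * ((Q - 5 * P) * (Q + P))) := by
    rw [beta3, h06, h02, h04, hδ]
    have r1 := hc.row_one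
    have r2 := hc.row_two
    have r3 := hc.row_three
    linear_combination l ^ 2 * ((-(Q / 3)) * r3 + ((Q - 2) / 5 - kap P Q * ((Q - 2 * P) / 9)) * r1 +
      kap P Q * (Q / 3) * r2)
  obtain ⟨hc1, hc2⟩ := sqrt_thirty_bounds
  obtain ⟨hβ0, hβl⟩ := hc.weight_bounds hc1 hc2 hsq hβ1
  obtain ⟨τ, hτ, hτβ, hs1, hs2⟩ := exists_deviation hβ0 hβl hδ0
  have habs := hc.isAbscissae hc1 hc2 hsq hβ1 hτ hτβ
  have hlκ : 0 ≤ l * kap P Q := mul_nonneg hl.le hc.kap_nonneg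
  set ξ := ((Q - 2 * P) / 9 - τ) / (Q / 3) with hξ
  set X := ((Q - 2 * P) / 9 + 4 / 405 * ((Q - 5 * P) * (Q + P)) / τ) / (Q / 3) with hX
  have hx1 : x1 θ ^ 2 = ξ := by
    have : (mom θ 2 2 - √((1 - beta1 θ) * beta2 θ / beta1 θ)) / mom θ 0 2 = ξ := by
      rw [hβ2, hs1 l hl.le, h22, h02, hξ, ← mul_sub, mul_div_mul_left _ _ hl.ne']
    rw [x1, this, Real.sq_sqrt habs.nonneg]
  have hx2 : x2 θ ^ 2 = X := by
    have : (mom θ 2 2 + √(beta1 θ * beta2 θ / (1 - beta1 θ))) / mom θ 0 2 = X := by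
      rw [hβ2, hs2 l hl.le, h22, h02, hX, ← mul_add, mul_div_mul_left _ _ hl.ne']
    rw [x2, this, Real.sq_sqrt (hc.abscissa_pos habs).le]
  have hlt : ξ < X := by
    rw [hξ, hX]
    refine div_lt_div_of_pos_right ?_ ha
    have : 0 < 4 / 405 * ((Q - 5 * P) * (Q + P)) / τ := div_pos hδ0 hτ
    linarith
  have hX8 := hc.abscissa_le habs
  have hκ := hc.kap_nonneg
  have hκX : kap P Q * X ≤ 0.436 * 0.8 :=
    mul_le_mul (hc.kap_le.trans (by linarith [hc.le_one])) hX8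
      (hc.abscissa_pos habs).le (by norm_num)
  have hκξ := mul_le_mul_of_nonneg_left hlt.le hκ
  have hη := hc.hgt_ge
  have haξ : Q / 3 * ξ = (Q - 2 * P) / 9 - τ := by rw [hξ, mul_div_cancel₀ _ ha.ne']
  have haX : Q / 3 * X = (Q - 2 * P) / 9 + 4 / 405 * ((Q - 5 * P) * (Q + P)) / τ := by
    rw [hX, mul_div_cancel₀ _ ha.ne']
  have hy1 : y1 θ ^ 2 = hgt P Q - kap P Q * ξ := by
    have : (mom θ 0 4 + √((1 - beta1 θ) * beta3 θ / beta1 θ)) / mom θ 0 2 =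
        hgt P Q - kap P Q * ξ := by
      rw [hβ3, hs1 _ hlκ, h04, h02, mul_assoc, ← mul_add, mul_div_mul_left _ _ hl.ne',
        div_eq_iff ha.ne']
      linear_combination kap P Q * haξ - hc.row_one
    rw [y1, this, Real.sq_sqrt (by linarith)]
  have hy2 : y2 θ ^ 2 = hgt P Q - kap P Q * X := by
    have : (mom θ 0 4 - √(beta1 θ * beta3 θ / (1 - beta1 θ))) / mom θ 0 2 =
        hgt P Q - kap P Q * X := by
      rw [hβ3, hs2 _ hlκ, h04, h02, mul_assoc, ← mul_sub, mul_div_mul_left _ _ hl.ne',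
        div_eq_iff ha.ne']
      linear_combination kap P Q * haX - hc.row_one
    rw [y2, this, Real.sq_sqrt (by linarith)]
  have hY1 : 0 < y1 θ ^ 2 := by rw [hy1]; linarith
  have hY2 : 0 < y2 θ ^ 2 := by rw [hy2]; linarith
  have hw1 : weight1 θ * y1 θ ^ 2 = beta1 θ * (l * (Q / 3)) := by
    rw [weight1, div_mul_cancel₀ _ hY1.ne', h02]
  have hw2 : weight2 θ * y2 θ ^ 2 = (1 - beta1 θ) * (l * (Q / 3)) := by
    rw [weight2, div_mul_cancel₀ _ hY2.ne', h02]
  -- The weighted deviations from the mean balance, which gives the first moment; with `hτβ` it also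
  -- gives the second.
  have hdτ : (1 - beta1 θ) * (4 / 405 * ((Q - 5 * P) * (Q + P)) / τ) = beta1 θ * τ := by
    rw [mul_div_assoc', ← hτβ]; field_simp
  refine ⟨?_, ?_, ?_, ?_, ?_, ?_, ?_, ?_, ?_⟩
  · rwa [hx1, hx2]
  · rwa [hx1, hx2]
  · rw [hx1, hy1]
  · rw [hx2, hy2]
  · exact pos_of_mul_pos_left (by rw [hw1]; positivity) hY1.le
  · have := sub_pos.mpr hβl
    exact pos_of_mul_pos_left (by rw [hw2]; positivity) hY2.le
  · rw [hw1, hw2]; ring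
  · rw [hw1, hw2, hx1, hx2]
    linear_combination l * beta1 θ * haξ + l * (1 - beta1 θ) * haX + l * hdτ
  · rw [show x1 θ ^ 4 = (x1 θ ^ 2) ^ 2 by ring, show x2 θ ^ 4 = (x2 θ ^ 2) ^ 2 by ring,
      hw1, hw2, hx1, hx2]
    refine mul_left_cancel₀ ha.ne' ?_
    have hdτ' : 4 / 405 * ((Q - 5 * P) * (Q + P)) / τ * τ = 4 / 405 * ((Q - 5 * P) * (Q + P)) :=
      div_mul_cancel₀ _ hτ.ne'
    generalize 4 / 405 * ((Q - 5 * P) * (Q + P)) / τ = D at *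
    rw [hδ] at hdτ' hτβ
    generalize (Q - 2 * P) / 9 = b at *
    generalize (Q - 4 * P) / 15 = e at *
    generalize Q / 3 = a at *
    linear_combination l * beta1 θ * (a * ξ + b - τ) * haξ +
      l * (1 - beta1 θ) * (a * X + b + D) * haX + l * (2 * b + D) * hdτ +
      l * hτβ + l * beta1 θ * hdτ'

end Neg
end OCAD

/-! ### The decomposition for `θ ≤ 0`. -/

namespace OCAD
namespace Neg

variable {θ P Q l : ℝ}

theorem Atoms.gauss (h : ScaledMoments θ P Q l) (ha : Atoms θ P Q l) :
    0 < weight3 (resMom θ) ∧ 0 < weight4 (resMom θ) ∧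
    coord3 (resMom θ) ∈ Set.Icc (0 : ℝ) 1 ∧ coord4 (resMom θ) ∈ Set.Icc (0 : ℝ) 1 ∧
    coord3 (resMom θ) ≠ coord4 (resMom θ) ∧
    weight3 (resMom θ) + weight4 (resMom θ) = resMom θ 0 ∧
    weight3 (resMom θ) * coord3 (resMom θ) ^ 2 + weight4 (resMom θ) * coord4 (resMom θ) ^ 2 =
      resMom θ 2 ∧
    weight3 (resMom θ) * coord3 (resMom θ) ^ 4 + weight4 (resMom θ) * coord4 (resMom θ) ^ 4 =
      resMom θ 4 ∧
    weight3 (resMom θ) * coord3 (resMom θ) ^ 6 + weight4 (resMom θ) * coord4 (resMom θ) ^ 6 =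
      resMom θ 6 := by
  have hl := h.pos
  have hs : OnCurve.IsAtomMoments P Q (x1 θ ^ 2) (x2 θ ^ 2)
      ((weight1 θ + weight2 θ) / l) ((weight1 θ * x1 θ ^ 2 + weight2 θ * x2 θ ^ 2) / l)
      ((weight1 θ * x1 θ ^ 4 + weight2 θ * x2 θ ^ 4) / l)
      ((weight1 θ * x1 θ ^ 6 + weight2 θ * x2 θ ^ 6) / l) := by
    have e1 := ha.ordinate_one
    have e2 := ha.ordinate_two
    have z0 := ha.zero
    have z1 := ha.one
    have z2 := ha.two
    rw [e1, e2] at z0 z1 z2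
    constructor
    · field_simp
      linear_combination 3 * z0
    · field_simp
      linear_combination 9 * z1
    · field_simp
      linear_combination 15 * z2
    · ring
  have key := h.onCurve.residual_moments ha.abscissae hs (m₀ := resMom θ 0 / l)
    (m₁ := resMom θ 2 / l) (m₂ := resMom θ 4 / l) (m₃ := resMom θ 6 / l)
    (by rw [resMom, h.mom_eq]; field_simp; push_cast; ring)
    (by rw [resMom, h.mom_eq]; field_simp; push_cast; ring)
    (by rw [resMom, h.mom_eq]; field_simp; push_cast; ring)
    (by rw [resMom, h.mom_eq]; field_simp; push_cast; ring)
  obtain ⟨h0, h1, h2, h3, h4, h5⟩ := key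
  have hl2 : 0 < l ^ 2 := by positivity
  refine twoPoint_gauss ((div_pos_iff_of_pos_right hl).mp h0) ((div_pos_iff_of_pos_right hl).mp h1)
    ?_ ?_ ((div_lt_div_iff_of_pos_right hl).mp h4) ?_
  · rwa [div_pow, div_mul_div_comm, ← sq, div_lt_div_iff_of_pos_right hl2] at h2
  · rwa [div_pow, div_mul_div_comm, ← sq, div_le_div_iff_of_pos_right hl2] at h3
  · rwa [← sub_div, ← sub_div, ← sub_div, div_pow, div_mul_div_comm, ← sq,
      div_le_div_iff_of_pos_right hl2] at h5

theorem moment_eq (h : ScaledMoments θ P Q l) (ha : Atoms θ P Q l) {i j : ℕ} (hij : i + j ≤ 3) :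
    mom θ (2 * i) (2 * j) =
      ∑ s, weights θ s * (nodesX θ s ^ (2 * i) * nodesY θ s ^ (2 * j)) := by
  obtain ⟨-, -, -, -, -, r0, r1, r2, r3⟩ := ha.gauss h
  have e1 := ha.ordinate_one
  have e2 := ha.ordinate_two
  rw [h.mom_eq]
  simp only [Fin.sum_univ_four, weights, nodesX, nodesY, Matrix.cons_val]
  have hz0 := ha.zero
  have hz1 := ha.one
  have hz2 := ha.two
  have c1 := h.onCurve.row_one
  have c2 := h.onCurve.row_two
  have c3 := h.onCurve.row_three
  rw [resMom, h.mom_eq] at r0 r1 r2 r3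
  generalize weight1 θ = ω₁ at *
  generalize weight2 θ = ω₂ at *
  generalize weight3 (resMom θ) = ω₃ at *
  generalize weight4 (resMom θ) = ω₄ at *
  generalize x1 θ = x₁ at *
  generalize x2 θ = x₂ at *
  generalize y1 θ = y₁ at *
  generalize y2 θ = y₂ at *
  generalize hgt P Q = η at *
  generalize kap P Q = κ at *
  -- One factor `y²` is replaced by `η - κ x²` at each atom; the kernel relations then turn the
  -- known moments into the next ones in `y²`.
  have q4 : ω₁ * y₁ ^ 4 + ω₂ * y₂ ^ 4 = l * ((Q - 2) / 5) := by
    linear_combination ω₁ * y₁ ^ 2 * e1 + ω₂ * y₂ ^ 2 * e2 + η * hz0 - κ * hz1 + l * c1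
  have q42 : ω₁ * y₁ ^ 4 * x₁ ^ 2 + ω₂ * y₂ ^ 4 * x₂ ^ 2 = l * ((Q - 2 * P - 2) / 15) := by
    linear_combination ω₁ * y₁ ^ 2 * x₁ ^ 2 * e1 + ω₂ * y₂ ^ 2 * x₂ ^ 2 * e2 + η * hz1 -
      κ * hz2 + l * c2
  have q6 : ω₁ * y₁ ^ 6 + ω₂ * y₂ ^ 6 = l * ((Q - 4) / 7) := by
    linear_combination ω₁ * y₁ ^ 4 * e1 + ω₂ * y₂ ^ 4 * e2 + η * q4 - κ * q42 + l * c3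
  obtain rfl | rfl | rfl | rfl : j = 0 ∨ j = 1 ∨ j = 2 ∨ j = 3 := by omega
  · obtain rfl | rfl | rfl | rfl : i = 0 ∨ i = 1 ∨ i = 2 ∨ i = 3 := by omega
    all_goals norm_num at r0 r1 r2 r3 ⊢
    · linear_combination -r0
    · linear_combination -r1
    · linear_combination -r2
    · linear_combination -r3
  · obtain rfl | rfl | rfl : i = 0 ∨ i = 1 ∨ i = 2 := by omega
    all_goals norm_num
    · linear_combination -hz0
    · linear_combination -hz1
    · linear_combination -hz2
  · obtain rfl | rfl : i = 0 ∨ i = 1 := by omega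
    all_goals norm_num
    · linear_combination -q4
    · linear_combination -q42
  · obtain rfl : i = 0 := by omega
    norm_num
    linear_combination -q6

theorem weights_pos (h : ScaledMoments θ P Q l) (ha : Atoms θ P Q l) (s : Fin 4) :
    0 < weights θ s := by
  obtain ⟨g3, g4, -⟩ := ha.gauss h
  revert s
  rw [Fin.forall_fin_succ, Fin.forall_fin_succ, Fin.forall_fin_two]
  exact ⟨ha.weight_one, ha.weight_two, g3, g4⟩

theorem nodesX_mem (h : ScaledMoments θ P Q l) (ha : Atoms θ P Q l) (s : Fin 4) :
    nodesX θ s ∈ Set.Icc (0 : ℝ) 1 := by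
  obtain ⟨-, -, gc3, gc4, -⟩ := ha.gauss h
  have hX8 := h.onCurve.abscissa_le ha.abscissae
  have unit : ∀ {z : ℝ}, 0 ≤ z → z ^ 2 ≤ 1 → z ∈ Set.Icc (0 : ℝ) 1 := fun h1 h2 =>
    ⟨h1, (sq_le_one_iff₀ h1).mp h2⟩
  revert s
  rw [Fin.forall_fin_succ, Fin.forall_fin_succ, Fin.forall_fin_two]
  exact ⟨unit (Real.sqrt_nonneg _) ((ha.lt.le.trans hX8).trans (by norm_num)),
    unit (Real.sqrt_nonneg _) (hX8.trans (by norm_num)), gc3, gc4⟩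

theorem nodesY_mem (h : ScaledMoments θ P Q l) (ha : Atoms θ P Q l) (s : Fin 4) :
    nodesY θ s ∈ Set.Icc (0 : ℝ) 1 := by
  have hκ := h.onCurve.kap_nonneg
  have hη := h.onCurve.hgt_le
  have unit : ∀ {z u : ℝ}, 0 ≤ z → z ^ 2 = hgt P Q - kap P Q * u ^ 2 → z ∈ Set.Icc (0 : ℝ) 1 :=
    fun {z u} h1 h2 => ⟨h1, (sq_le_one_iff₀ h1).mp
      (by rw [h2]; linarith [mul_nonneg hκ (sq_nonneg u)])⟩
  revert s
  rw [Fin.forall_fin_succ, Fin.forall_fin_succ, Fin.forall_fin_two]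
  exact ⟨unit (Real.sqrt_nonneg _) ha.ordinate_one, unit (Real.sqrt_nonneg _) ha.ordinate_two,
    by simp [nodesY], by simp [nodesY]⟩

/-- The first two orbits have different abscissae and lie off the axis `y = 0`; the last two are
different points on it. -/
theorem Atoms.injective_nodes (h : ScaledMoments θ P Q l) (ha : Atoms θ P Q l) :
    Function.Injective (fun s => (nodesX θ s, nodesY θ s)) := by
  have hne := (ha.gauss h).2.2.2.2.1
  have hx : x1 θ ≠ x2 θ := fun he => by have := ha.lt; rw [he] at this; exact lt_irrefl _ this
  have hX8 := h.onCurve.abscissa_le ha.abscissae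
  have hκ := h.onCurve.kap_nonneg
  have hκX : kap P Q * x2 θ ^ 2 ≤ 0.436 * 0.8 :=
    mul_le_mul (h.onCurve.kap_le.trans (by linarith [h.onCurve.le_one])) hX8
      (sq_nonneg _) (by norm_num)
  have hκξ := mul_le_mul_of_nonneg_left ha.lt.le hκ
  have hη := h.onCurve.hgt_ge
  have hy1 : y1 θ ≠ 0 := fun he => by
    have := ha.ordinate_one; rw [he] at this; linarith
  have hy2 : y2 θ ≠ 0 := fun he => by
    have := ha.ordinate_two; rw [he] at this; linarith
  intro s r hsr
  rw [Prod.mk.injEq] at hsr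
  fin_cases s <;> fin_cases r <;>
    simp_all [nodesX, nodesY, eq_comm]

/-- The cubic `y (κ x² + y² - η)` vanishes at all nodes. -/
theorem Atoms.exists_cubic_vanishing (ha : Atoms θ P Q l) :
    ∃ v : Fin 10 → ℝ, v ≠ 0 ∧ ∀ s, symMean (cubic v ^ 2) (nodesX θ s) (nodesY θ s) = 0 := by
  have h1 : kap P Q * x1 θ ^ 2 + y1 θ ^ 2 - hgt P Q = 0 := by linarith [ha.ordinate_one]
  have h2 : kap P Q * x2 θ ^ 2 + y2 θ ^ 2 - hgt P Q = 0 := by linarith [ha.ordinate_two]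
  refine ⟨![0, 0, -hgt P Q, 0, 0, 0, 0, kap P Q, 0, 1], fun h => by simpa using congrFun h 9, ?_⟩
  have hv : ∀ x y, val (cubic ![0, 0, -hgt P Q, 0, 0, 0, 0, kap P Q, 0, 1] ^ 2) x y =
      (y * (kap P Q * x ^ 2 + y ^ 2 - hgt P Q)) ^ 2 := fun x y => by
    rw [val_pow, val_cubic]
    simp only [Matrix.cons_val]
    ring
  rw [Fin.forall_fin_succ, Fin.forall_fin_succ, Fin.forall_fin_two]
  refine ⟨?_, ?_, ?_, ?_⟩ <;> simp [symMean, hv, nodesX, nodesY, h1, h2]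

/-- The cubic `x (κ y² + x² - η)` vanishes at the mirror images of all nodes. -/
theorem Atoms.exists_swap_cubic_vanishing (ha : Atoms θ P Q l) :
    ∃ v : Fin 10 → ℝ, v ≠ 0 ∧ ∀ s, symMean (cubic v ^ 2) (nodesY θ s) (nodesX θ s) = 0 := by
  have h1 : kap P Q * x1 θ ^ 2 + y1 θ ^ 2 - hgt P Q = 0 := by linarith [ha.ordinate_one]
  have h2 : kap P Q * x2 θ ^ 2 + y2 θ ^ 2 - hgt P Q = 0 := by linarith [ha.ordinate_two]
  refine ⟨![0, -hgt P Q, 0, 0, 0, 0, 1, 0, kap P Q, 0], fun h => by simpa using congrFun h 6, ?_⟩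
  have hv : ∀ x y, val (cubic ![0, -hgt P Q, 0, 0, 0, 0, 1, 0, kap P Q, 0] ^ 2) x y =
      (x * (kap P Q * y ^ 2 + x ^ 2 - hgt P Q)) ^ 2 := fun x y => by
    rw [val_pow, val_cubic]
    simp only [Matrix.cons_val]
    ring
  rw [Fin.forall_fin_succ, Fin.forall_fin_succ, Fin.forall_fin_two]
  refine ⟨?_, ?_, ?_, ?_⟩ <;> simp [symMean, hv, nodesX, nodesY, h1, h2]

end Neg
end OCAD

/-! ### Reflection to `θ ≥ 0`. -/

namespace OCAD

theorem wStar_neg (θ : ℝ) : wStar (-θ) = wStar θ := by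
  rw [wStar_eq, wStar_eq, abs_neg]

theorem mom_swap (θ : ℝ) (i j : ℕ) : mom θ i j = mom (-θ) j i := by
  rw [mom, mom, wStar_neg]
  ring

namespace Neg

theorem isSymmetricCAD {θ : ℝ} (hθ : -1 ≤ θ) (hθ0 : θ ≤ 0) {k : ℕ} (hk : k = 6 ∨ k = 7) :
    IsSymmetricCAD (polySpace k) θ (wStar θ) (weights θ) (nodesX θ) (nodesY θ) := by
  obtain ⟨P, Q, l, h⟩ := exists_scaledMoments hθ hθ0
  exact ⟨exact_of_moments fun i j hij => moment_eq h h.atoms (by omega),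
    wStar_pos (abs_le.mpr ⟨hθ, by linarith⟩), weights_pos h h.atoms, nodesX_mem h h.atoms,
    nodesY_mem h h.atoms⟩

theorem injective_nodes {θ : ℝ} (hθ : -1 ≤ θ) (hθ0 : θ ≤ 0) :
    Function.Injective (fun s => (nodesX θ s, nodesY θ s)) := by
  obtain ⟨P, Q, l, h⟩ := exists_scaledMoments hθ hθ0
  exact h.atoms.injective_nodes h

theorem exists_cubic_vanishing {θ : ℝ} (hθ : -1 ≤ θ) (hθ0 : θ ≤ 0) :
    ∃ v : Fin 10 → ℝ, v ≠ 0 ∧ ∀ s, symMean (cubic v ^ 2) (nodesX θ s) (nodesY θ s) = 0 := by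
  obtain ⟨P, Q, l, h⟩ := exists_scaledMoments hθ hθ0
  exact h.atoms.exists_cubic_vanishing

end Neg

namespace Pos

variable (θ : ℝ)

theorem beta1_eq : beta1 θ = Neg.beta1 (-θ) := by
  simp only [beta1, Neg.beta1, mom_swap θ, neg_sq]

theorem beta2_eq : beta2 θ = Neg.beta3 (-θ) := by
  simp only [beta2, Neg.beta3, mom_swap θ]

theorem beta3_eq : beta3 θ = Neg.beta2 (-θ) := by
  simp only [beta3, Neg.beta2, mom_swap θ]

theorem x1_eq : x1 θ = Neg.y1 (-θ) := by
  simp only [x1, Neg.y1, mom_swap θ, beta1_eq, beta2_eq]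

theorem y1_eq : y1 θ = Neg.x1 (-θ) := by
  simp only [y1, Neg.x1, mom_swap θ, beta1_eq, beta3_eq]

theorem x2_eq : x2 θ = Neg.y2 (-θ) := by
  simp only [x2, Neg.y2, mom_swap θ, beta1_eq, beta2_eq]

theorem y2_eq : y2 θ = Neg.x2 (-θ) := by
  simp only [y2, Neg.x2, mom_swap θ, beta1_eq, beta3_eq]

theorem weight1_eq : weight1 θ = Neg.weight1 (-θ) := by
  simp only [weight1, Neg.weight1, mom_swap θ, beta1_eq, x1_eq]

theorem weight2_eq : weight2 θ = Neg.weight2 (-θ) := by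
  simp only [weight2, Neg.weight2, mom_swap θ, beta1_eq, x2_eq]

theorem resMom_eq : resMom θ = Neg.resMom (-θ) := by
  funext k
  simp only [resMom, Neg.resMom, mom_swap θ, weight1_eq, weight2_eq, y1_eq, y2_eq]

theorem weights_eq : weights θ = Neg.weights (-θ) := by
  simp only [weights, Neg.weights, weight1_eq, weight2_eq, resMom_eq]

theorem nodesX_eq : nodesX θ = Neg.nodesY (-θ) := by
  simp only [nodesX, Neg.nodesY, x1_eq, x2_eq]

theorem nodesY_eq : nodesY θ = Neg.nodesX (-θ) := by
  simp only [nodesY, Neg.nodesX, y1_eq, y2_eq, resMom_eq]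

variable {θ}

theorem isSymmetricCAD (hθ : θ ≤ 1) (hθ0 : 0 ≤ θ) {k : ℕ} (hk : k = 6 ∨ k = 7) :
    IsSymmetricCAD (polySpace k) θ (wStar θ) (weights θ) (nodesX θ) (nodesY θ) := by
  obtain ⟨P, Q, l, h⟩ := exists_scaledMoments (neg_le_neg hθ) (neg_nonpos.mpr hθ0)
  rw [weights_eq, nodesX_eq, nodesY_eq]
  refine ⟨exact_of_moments fun i j hij => ?_,
    wStar_pos (abs_le.mpr ⟨by linarith, hθ⟩), Neg.weights_pos h h.atoms,
    Neg.nodesY_mem h h.atoms, Neg.nodesX_mem h h.atoms⟩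
  rw [mom_swap, Neg.moment_eq h h.atoms (by omega)]
  exact Finset.sum_congr rfl fun s _ => by rw [mul_comm (_ ^ _)]

theorem injective_nodes (hθ : θ ≤ 1) (hθ0 : 0 ≤ θ) :
    Function.Injective (fun s => (nodesX θ s, nodesY θ s)) := by
  rw [nodesX_eq, nodesY_eq]
  exact Prod.swap_injective.comp
    (Neg.injective_nodes (neg_le_neg hθ) (neg_nonpos.mpr hθ0))

theorem exists_cubic_vanishing (hθ : θ ≤ 1) (hθ0 : 0 ≤ θ) :
    ∃ v : Fin 10 → ℝ, v ≠ 0 ∧ ∀ s, symMean (cubic v ^ 2) (nodesX θ s) (nodesY θ s) = 0 := by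
  obtain ⟨P, Q, l, h⟩ := exists_scaledMoments (neg_le_neg hθ) (neg_nonpos.mpr hθ0)
  rw [nodesX_eq, nodesY_eq]
  exact h.atoms.exists_swap_cubic_vanishing

end Pos
end OCAD

theorem theorem5p10 (θ : ℝ) (hθ : θ ∈ Set.Icc (-1 : ℝ) 1) :
    -- the explicit symmetric CAD is feasible and optimal for both spaces, with four distinct orbits
    (θ ≤ 0 →
      (∀ k : ℕ, k = 6 ∨ k = 7 →
        OCAD.IsSymmetricOCAD (OCAD.polySpace k) θ (OCAD.wStar θ)
          (OCAD.Neg.weights θ) (OCAD.Neg.nodesX θ) (OCAD.Neg.nodesY θ)) ∧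
      Function.Injective (fun s => (OCAD.Neg.nodesX θ s, OCAD.Neg.nodesY θ s))) ∧
    (0 ≤ θ →
      (∀ k : ℕ, k = 6 ∨ k = 7 →
        OCAD.IsSymmetricOCAD (OCAD.polySpace k) θ (OCAD.wStar θ)
          (OCAD.Pos.weights θ) (OCAD.Pos.nodesX θ) (OCAD.Pos.nodesY θ)) ∧
      Function.Injective (fun s => (OCAD.Pos.nodesX θ s, OCAD.Pos.nodesY θ s))) ∧
    -- duality: optimal weight, infimum over nonnegative polynomials, infimum over squares
    (∀ k : ℕ, k = 6 ∨ k = 7 →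
      OCAD.optimalWeight (OCAD.polySpace k) θ = OCAD.wStar θ ∧
      (OCAD.optimalWeight (OCAD.polySpace k) θ : EReal) =
        OCAD.phiStar θ (OCAD.nonnegPart (OCAD.polySpace k)) ∧
      OCAD.phiStar θ (OCAD.nonnegPart (OCAD.polySpace k)) =
        OCAD.phiStar θ (OCAD.squares (OCAD.polySpace (k / 2))) ∧
      (∃ p, OCAD.IsCriticalPositive (OCAD.polySpace k) θ p) ∧
      (∃ q ∈ OCAD.polySpace (k / 2), q ≠ 0 ∧
        OCAD.IsCriticalPositive (OCAD.polySpace k) θ (q ^ 2))) ∧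
    OCAD.phiStar θ (OCAD.squares (OCAD.polySpace 3)) = (OCAD.wStar θ : EReal) ∧
    -- the weight is the smallest real root of `det (M_Ω - φ M_θ)`
    IsLeast {φ : ℝ | (OCAD.massMatrix - φ • OCAD.bdryMatrix θ).det = 0} (OCAD.wStar θ) := by
  obtain ⟨h1, h2⟩ := hθ
  have hneg := fun h0 : θ ≤ 0 => OCAD.optimal_of_cubic_vanishing ⟨h1, h2⟩
    (fun _ hk => OCAD.Neg.isSymmetricCAD h1 h0 hk)
    (OCAD.Neg.exists_cubic_vanishing h1 h0).choose_spec.1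
    (OCAD.Neg.exists_cubic_vanishing h1 h0).choose_spec.2
  have hpos := fun h0 : 0 ≤ θ => OCAD.optimal_of_cubic_vanishing ⟨h1, h2⟩
    (fun _ hk => OCAD.Pos.isSymmetricCAD h2 h0 hk)
    (OCAD.Pos.exists_cubic_vanishing h2 h0).choose_spec.1
    (OCAD.Pos.exists_cubic_vanishing h2 h0).choose_spec.2
  refine ⟨fun h0 => ⟨(hneg h0).1, OCAD.Neg.injective_nodes h1 h0⟩,
    fun h0 => ⟨(hpos h0).1, OCAD.Pos.injective_nodes h2 h0⟩, ?_⟩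
  rcases le_total θ 0 with h0 | h0
  · exact (hneg h0).2
  · exact (hpos h0).2
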